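/- \textbf{Local superexponential estimate.} Setting. For $n\in\mathbb N=\{1,2,\dots\}$ let $\mathbb T_n=\frac1n\mathbb Z/\mathbb Z$ and $\Omega_n=\{0,1\}^{\mathbb T_n}$; write $x\sim y$ if $|x-y|=\frac1n$ on the circle, let $\eta^{x,y}$ be $\eta$ with the values at $x$ and $y$ exchanged, and let $(\tau_x\eta)(z)=\eta(z+x)$. A function on $\Omega=\{0,1\}^{\mathbb Z}$ is called local if it depends on finitely many coordinates; for $n$ large it is viewed as a function on $\Omega_n$ by identifying $\mathbb T_n$ with $\{\lfloor-\frac n2+1\rfloor,\dots,\lfloor\frac n2\rfloor\}\subset\mathbb Z$ (the site $\frac xn$ corresponds to $x$). Let $c^{+},c^{-}:\Omega\to[0,\infty)$ be local, and let $T>0$. For each $n$ let $(\eta^n_t,x^n_t)_{t\in[0,T]}$ be the continuous-time Markov process with c\`adl\`ag paths in $\Omega_n\times\mathbb T_n$ and generator \[ L_nF(\eta,x)=n^2\sum_{\{y,z\}:\,y\sim z}\big(F(\eta^{y,z},x)-F(\eta,x)\big)+n\sum_{z=\pm1}c^{z}(\tau_x\eta)\big(F(\eta,x+\tfrac zn)-F(\eta,x)\big)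 \] (the first sum is over unordered pairs of neighbours), with initial law $\mu^n\otimes\delta_0$, where $\mu^n$ is an arbitrary probability measure on $\Omega_n$. Let $\mathbb P_n$ be its law. Let $\xi^n_t=\tau_{x^n_t}\eta^n_t$ be the environment seen from the walker. Let $\hat\pi^n_t(dy)=\sum_{x\in\mathbb T_n}\xi^n_t(x)\,(1-n|y-x|)^+\,dy$ be its empirical measure on $\mathbb T=\mathbb R/\mathbb Z$. For $\epsilon\in(0,\frac12)$ let $\iota_\epsilon=\frac1\epsilon\mathbf 1_{(0,\epsilon]}$, and write $\hat\pi^n_t(\iota_\epsilon)=\int\iota_\epsilon\,d\hat\pi^n_t\in[0,1]$. For local $f:\Omega\to\mathbb R$ and $\rho\in[0,1]$ let $\bar f(\rho)=\int f\,d\nu_\rho$, where $\nu_\rho$ is the Bernoulli product measure of density $\rho$ on $\Omega$. Lemma. For every local function $f:\Omega\to\mathbb R$, every $\delta>0$ and every $t\in[0,T]$, \[ \limsup_{\epsilon\downarrow0}\ \limsup_{n\to\infty}\ \frac1n\log\mathbb P_n\Big(\Big|\int_0^t\big\{f(\xi^n_s)-\bar f\big(\hat\pi^n_s(\iota_\epsilon)\big)\big\}\,ds\Big|>\delta\Big)=-\infty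 , \] with the convention $\log 0=-\infty$. -/

import Mathlib

open MeasureTheory ProbabilityTheory Filter Topology Set

noncomputable section

namespace ExclusionWalk

/-- The discrete circle `𝕋ₙ = (1/n)ℤ / ℤ`; the site `x / n` is coded by the class of `x`. -/
abbrev Site (n : ℕ+) : Type := ZMod (n : ℕ)

/-- Particle configurations on the discrete circle (`true` is a particle). -/
abbrev Config (n : ℕ+) : Type := Site n → Bool

/-- Particle configurations on `ℤ`. -/
abbrev ZConfig : Type := ℤ → Bool

/-- States of the pair (environment, walker). -/
abbrev State (n : ℕ+) : Type := Config n × Site n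

/-- A function of the configuration on `ℤ` is local if it depends on finitely many sites only. -/
def IsLocal (f : ZConfig → ℝ) : Prop := ∃ A : Finset ℤ, DependsOn f (A : Set ℤ)

/-- The function on `{0,1}^𝕋ₙ` induced by a function on `{0,1}^ℤ`. As soon as `n` is so large that
`f` depends only on the sites of `{⌊-n/2+1⌋, …, ⌊n/2⌋}`, this is the lifting of `f` through the
identification of `𝕋ₙ` with that window. -/
def lift (n : ℕ+) (f : ZConfig → ℝ) (ξ : Config n) : ℝ := f fun z => ξ (z : Site n)

/-- The shift `(τ_x η)(z) = η(z + x)`. -/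
def shift {n : ℕ+} (x : Site n) (η : Config n) : Config n := fun z => η (z + x)

/-- The configuration `η^{x,y}`, in which the values at `x` and `y` are exchanged. -/
def exchange {n : ℕ+} (x y : Site n) (η : Config n) : Config n := fun z => η (Equiv.swap x y z)

/-- The sites `x` and `y` are at distance `1/n` on the circle. -/
def Neighbours {n : ℕ+} (x y : Site n) : Prop := x ≠ y ∧ (y = x + 1 ∨ x = y + 1)

instance {n : ℕ+} (x y : Site n) : Decidable (Neighbours x y) := by
  unfold Neighbours; infer_instance

/-- The generator of the pair (exclusion process, walker): the values at each unordered pair of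
neighbours are exchanged at rate `n²` (each pair occurs twice in the double sum), and the walker
jumps from `x` to `x + z/n`, `z = ±1`, at rate `n c^z(η; x)`, where `c^z(η; x) = c^z(τ_x η)`. -/
def generator (n : ℕ+) (c : ℤˣ → ZConfig → ℝ) (g : State n → ℝ) (a : State n) : ℝ :=
  (n : ℝ) ^ 2 * ((1 / 2) * ∑ x : Site n, ∑ y : Site n,
      if Neighbours x y then g (exchange x y a.1, a.2) - g a else 0)
  + (n : ℝ) * ∑ z : ℤˣ, lift n (c z) (shift a.2 a.1) *
      (g (a.1, a.2 + ((z : ℤ) : Site n)) - g a)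

/-- The matrix of the generator: `Q a b` is the value at `a` of the generator applied to the
indicator function of `b`. -/
def rateMatrix (n : ℕ+) (c : ℤˣ → ZConfig → ℝ) : Matrix (State n) (State n) ℝ :=
  Matrix.of fun a b => generator n c (Pi.single b 1) a

/-- The transition probabilities `exp (t Q)` of the pair. -/
def transition (n : ℕ+) (c : ℤˣ → ZConfig → ℝ) (t : ℝ) : Matrix (State n) (State n) ℝ :=
  NormedSpace.exp (t • rateMatrix n c)

/-- `X = (η_t, x_t)_{0 ≤ t ≤ T}`, defined on a probability space with probability `P`, is the
Markov process of the environment and the walker: it has càdlàg paths (in a finite, discrete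
space), and its finite-dimensional distributions are those of the Markov process with the above
generator, started from `μ ⊗ δ₀`. -/
structure IsEnvironmentAndWalk {E : Type*} [MeasurableSpace E] (P : Measure E) (n : ℕ+)
    (c : ℤˣ → ZConfig → ℝ) (T : ℝ) (μ : PMF (Config n)) (X : ℝ → E → State n) : Prop where
  measurable : ∀ t ∈ Icc 0 T, ∀ a : State n, MeasurableSet {ω | X t ω = a}
  right_continuous : ∀ ω, ∀ t ∈ Ico 0 T, ∀ᶠ s in 𝓝[>] t, X s ω = X t ω
  left_limits : ∀ ω, ∀ t ∈ Ioc 0 T, ∃ a : State n, ∀ᶠ s in 𝓝[<] t, X s ω = a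
  law : ∀ (k : ℕ) (t : Fin (k + 1) → ℝ), Monotone t → t 0 = 0 → (∀ i, t i ≤ T) →
    ∀ a : Fin (k + 1) → State n,
      P.real {ω | ∀ i, X (t i) ω = a i} =
        ((μ (a 0).1).toReal * if (a 0).2 = 0 then 1 else 0) *
          ∏ i : Fin k, transition n c (t i.succ - t i.castSucc) (a i.castSucc) (a i.succ)

/-- The environment as seen by the walker, `ξ(z) = η(x + z)`. -/
def seenFromWalker {n : ℕ+} (a : State n) : Config n := shift a.2 a.1

/-- The finite element `δ_x^n(y) = (1 - n |y - x|)⁺` on the circle `𝕋 = ℝ / ℤ`. -/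
def finiteElement (n : ℕ+) (x : Site n) (y : UnitAddCircle) : ℝ :=
  max (1 - (n : ℝ) * ‖y - ZMod.toAddCircle x‖) 0

/-- The density `∑ₓ ξ(x) δ_x^n(y)` of the empirical measure of `ξ` with respect to Lebesgue measure
on the circle. -/
def empiricalDensity (n : ℕ+) (ξ : Config n) (y : UnitAddCircle) : ℝ :=
  ∑ x : Site n, if ξ x then finiteElement n x y else 0

/-- The integral of `ι_ε = ε⁻¹ 1_{(0, ε]}` with respect to the empirical measure of `ξ`. -/
def empiricalBox (n : ℕ+) (ξ : Config n) (ε : ℝ) : ℝ :=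
  (1 / ε) * ∫ y in (0 : ℝ)..ε, empiricalDensity n ξ (y : UnitAddCircle)

theorem empiricalDensity_nonneg (n : ℕ+) (ξ : Config n) (y : UnitAddCircle) :
    0 ≤ empiricalDensity n ξ y := by
  unfold empiricalDensity finiteElement
  refine Finset.sum_nonneg fun x _ => ?_
  split_ifs <;> simp

theorem finiteElement_le (n : ℕ+) (r : ℝ) (x : Site n) :
    finiteElement n x (r : UnitAddCircle) ≤
      (if x = ((⌊n * r⌋ : ℤ) : Site n) then 1 - Int.fract (n * r) else 0) +
      (if x = ((⌊n * r⌋ + 1 : ℤ) : Site n) then Int.fract (n * r) else 0) := by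
  have hn : (0 : ℝ) < (n : ℝ) := by exact_mod_cast n.pos
  have h0 := Int.fract_nonneg ((n : ℝ) * r)
  have h1 := Int.fract_lt_one ((n : ℝ) * r)
  have hfl := Int.floor_add_fract ((n : ℝ) * r)
  obtain ⟨k, rfl⟩ := ZMod.intCast_surjective x
  set m : ℤ := round (r - (k : ℝ) / n) with hm
  have hnorm : (n : ℝ) * ‖(r : UnitAddCircle) - ZMod.toAddCircle ((k : ℤ) : Site n)‖
      = |(n : ℝ) * r - ((k + n * m : ℤ) : ℝ)| := by
    rw [ZMod.toAddCircle_intCast, ← AddCircle.coe_sub, UnitAddCircle.norm_eq, ← hm]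
    nth_rewrite 1 [← abs_of_pos hn]
    rw [← abs_mul]
    congr 1
    push_cast
    field_simp
    ring
  have hcast : ((k : ℤ) : Site n) = ((k + n * m : ℤ) : Site n) := by
    push_cast
    simp
  unfold finiteElement
  rw [hnorm, hcast]
  set j : ℤ := k + n * m
  set u : ℝ := Int.fract ((n : ℝ) * r)
  have hs1 : (0 : ℝ) ≤ if ((j : ℤ) : Site n) = ((⌊(n : ℝ) * r⌋ : ℤ) : Site n) then 1 - u else 0 := by
    split_ifs <;> linarith
  have hs2 : (0 : ℝ) ≤ if ((j : ℤ) : Site n) = ((⌊(n : ℝ) * r⌋ + 1 : ℤ) : Site n) then u else 0 := by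
    split_ifs <;> linarith
  refine max_le ?_ (by linarith)
  have habs : |(n : ℝ) * r - j| = |(⌊(n : ℝ) * r⌋ : ℝ) + u - j| := by rw [hfl]
  rw [habs]
  rcases lt_trichotomy j ⌊(n : ℝ) * r⌋ with h | h | h
  · have : (j : ℝ) + 1 ≤ (⌊(n : ℝ) * r⌋ : ℝ) := by exact_mod_cast h
    have := le_abs_self ((⌊(n : ℝ) * r⌋ : ℝ) + u - j)
    linarith
  · rw [if_pos (by rw [h])]
    have := le_abs_self ((⌊(n : ℝ) * r⌋ : ℝ) + u - j)
    have : (j : ℝ) = (⌊(n : ℝ) * r⌋ : ℝ) := by rw [h]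
    linarith
  · rcases eq_or_lt_of_le (Int.add_one_le_iff.mpr h) with h' | h'
    · rw [← h', if_pos (c := (((⌊(n : ℝ) * r⌋ + 1 : ℤ) : Site n) = _)) rfl]
      rw [← h'] at hs1
      have := neg_le_abs ((⌊(n : ℝ) * r⌋ : ℝ) + u - ((⌊(n : ℝ) * r⌋ + 1 : ℤ) : ℝ))
      push_cast at this hs1 ⊢
      linarith
    · have : (⌊(n : ℝ) * r⌋ : ℝ) + 1 + 1 ≤ (j : ℝ) := by exact_mod_cast h'
      have := neg_le_abs ((⌊(n : ℝ) * r⌋ : ℝ) + u - j)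
      linarith

theorem empiricalDensity_le_one (n : ℕ+) (ξ : Config n) (y : UnitAddCircle) :
    empiricalDensity n ξ y ≤ 1 := by
  induction y using QuotientAddGroup.induction_on with
  | H r =>
    have h : ∀ x : Site n, (if ξ x then finiteElement n x (r : UnitAddCircle) else 0) ≤
        (if x = ((⌊n * r⌋ : ℤ) : Site n) then 1 - Int.fract (n * r) else 0) +
        (if x = ((⌊n * r⌋ + 1 : ℤ) : Site n) then Int.fract (n * r) else 0) := by
      intro x
      refine le_trans ?_ (finiteElement_le n r x)
      split_ifs
      · exact le_rfl
      · exact le_max_right _ _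
    refine (Finset.sum_le_sum fun x _ => h x).trans ?_
    rw [Finset.sum_add_distrib]
    simp

/-- The empirical measure gives the box a density in `[0, 1]`. -/
theorem empiricalBox_mem (n : ℕ+) (ξ : Config n) (ε : ℝ) :
    empiricalBox n ξ ε ∈ unitInterval := by
  have h0 := empiricalDensity_nonneg n ξ
  have h1 : ‖∫ y in (0 : ℝ)..ε, empiricalDensity n ξ (y : UnitAddCircle)‖ ≤ 1 * |ε - 0| :=
    intervalIntegral.norm_integral_le_of_norm_le_const fun y _ => by
      rw [Real.norm_of_nonneg (h0 _)]
      exact empiricalDensity_le_one n ξ _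
  constructor
  · unfold empiricalBox
    rcases le_total 0 ε with h | h
    · exact mul_nonneg (by positivity) (intervalIntegral.integral_nonneg h fun y _ => h0 _)
    · rw [intervalIntegral.integral_symm, mul_neg, ← neg_mul]
      refine mul_nonneg ?_ (intervalIntegral.integral_nonneg h fun y _ => h0 _)
      rw [neg_nonneg]
      exact one_div_nonpos.mpr h
  · refine (le_abs_self _).trans ?_
    unfold empiricalBox
    rw [abs_mul, abs_div, abs_one, one_div]
    rw [Real.norm_eq_abs, one_mul, sub_zero] at h1
    calc |ε|⁻¹ * _ ≤ |ε|⁻¹ * |ε| := mul_le_mul_of_nonneg_left h1 (by positivity)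
      _ ≤ 1 := inv_mul_le_one

/-- The Bernoulli product measure `ν_ρ` on `{0,1}^ℤ`. -/
def bernoulliProduct (ρ : unitInterval) : Measure ZConfig :=
  Measure.infinitePi fun _ : ℤ => bernoulliMeasure true false ρ

/-- The mean `f̄(ρ) = ∫ f dν_ρ`. -/
def bernoulliMean (f : ZConfig → ℝ) (ρ : unitInterval) : ℝ := ∫ η, f η ∂bernoulliProduct ρ

/-- `f(ξ) - f̄(π̂(ι_ε))`, where `π̂` is the empirical measure of `ξ`. -/
def localError (n : ℕ+) (f : ZConfig → ℝ) (ε : ℝ) (ξ : Config n) : ℝ :=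
  lift n f ξ - bernoulliMean f ⟨empiricalBox n ξ ε, empiricalBox_mem n ξ ε⟩

end ExclusionWalk

end

/-! Exponential Chebyshev plus a spectral bound. For fixed `α > 0`, the probability that `±nα ∫
localError` exceeds `nαδ` is at most `exp (-nαδ)` times an exponential moment. By Feynman-Kac that
moment is governed by the largest value of the quadratic form of `Q ± nα · localError` on `ℓ²` of
the counting measure. An arbitrary initial law costs only the factor `√(card) ≤ exp n`, which does
not depend on `α`.

The exclusion part of `Q` is symmetric for the counting measure and contributes at most `-(n²/4)`
times the Dirichlet form `bondEnergy`, for each frozen walker position. The walk is not symmetric,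
but it jumps at rate of order `n` and adds at most `nK`. It remains to bound the perturbation by
`n²/4` Dirichlet forms plus a small multiple of `n`.

This is the static replacement estimate `exists_abs_sum_localError_le`. A local function is a
combination of products of one-site functions, and its Bernoulli mean at the box density is the same
combination of products of box averages. Factors are averaged one by one: comparing sites `b` and
`y` amounts to exchanging their values, a change of variables that preserves the counting measure
and costs at most `4|b - y|` Dirichlet forms. Since `|b - y|` is at most about `εn` and the
available energy is of order `n²`, one step reaches the macroscopic box. With Young's inequality
suitably weighted, the remainder is `nβ`, where `β` tends to `16α²C²ε` as `n → ∞`.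

The exponential rate is thus at most `2 + (K + β + 1)t - αδ`. Taking `ε` small after `α` gives `β <
1`, and `α` is arbitrary. -/

noncomputable section

namespace ExclusionWalk

/-! ### Feynman-Kac bound through split time steps -/

section Trotter

open scoped Matrix.Norms.L2Operator Matrix

variable {S : Type*} [Fintype S] [DecidableEq S]

/-- With `x = r l + r²‖A‖²/2`, expanding the square gives `‖v + r A v‖² ≤ (1 + 2x)‖v‖² ≤ (1 +
x)²‖v‖²`. No symmetry of `A` is needed: only its quadratic form enters at first order. -/
theorem norm_one_add_smul_le (A : Matrix S S ℝ) (l : ℝ)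
    (hA : ∀ v : S → ℝ, v ⬝ᵥ (A *ᵥ v) ≤ l * (v ⬝ᵥ v)) {r : ℝ} (hr : 0 ≤ r)
    (hpos : 0 ≤ 1 + (r * l + r ^ 2 * ‖A‖ ^ 2 / 2)) :
    ‖1 + r • A‖ ≤ 1 + (r * l + r ^ 2 * ‖A‖ ^ 2 / 2) := by
  rw [Matrix.l2_opNorm_def]
  refine ContinuousLinearMap.opNorm_le_bound _ hpos fun v => ?_
  have hnorm : ∀ w : S → ℝ, ‖WithLp.toLp 2 w‖ ^ 2 = w ⬝ᵥ w := fun w => by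
    rw [EuclideanSpace.real_norm_sq_eq]
    simp [dotProduct, sq]
  have hv := hnorm v.ofLp
  have hAv := hnorm (A *ᵥ v.ofLp)
  have hle : ‖WithLp.toLp 2 (A *ᵥ v.ofLp)‖ ≤ ‖A‖ * ‖v‖ := Matrix.l2_opNorm_mulVec A v
  have hsum := hnorm (v.ofLp + r • (A *ᵥ v.ofLp))
  change ‖WithLp.toLp 2 ((1 + r • A) *ᵥ v.ofLp)‖ ≤ _
  rw [Matrix.add_mulVec, Matrix.one_mulVec, Matrix.smul_mulVec]
  refine abs_le_of_sq_le_sq' ?_ (mul_nonneg hpos (norm_nonneg v)) |>.2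
  rw [hsum, mul_pow]
  have hexp : (v.ofLp + r • (A *ᵥ v.ofLp)) ⬝ᵥ (v.ofLp + r • (A *ᵥ v.ofLp)) =
      v.ofLp ⬝ᵥ v.ofLp + 2 * r * (v.ofLp ⬝ᵥ (A *ᵥ v.ofLp))
        + r ^ 2 * ((A *ᵥ v.ofLp) ⬝ᵥ (A *ᵥ v.ofLp)) := by
    simp only [add_dotProduct, dotProduct_add, smul_dotProduct, dotProduct_smul, smul_eq_mul]
    rw [dotProduct_comm (A *ᵥ v.ofLp) v.ofLp]
    ring
  rw [hexp, ← hAv, ← hv]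
  have h1 := mul_le_mul_of_nonneg_left (hA v.ofLp) (by positivity : 0 ≤ 2 * r)
  have h2 : ‖WithLp.toLp 2 (A *ᵥ v.ofLp)‖ ^ 2 ≤ (‖A‖ * ‖v‖) ^ 2 := by gcongr
  have h3 := mul_le_mul_of_nonneg_left h2 (by positivity : 0 ≤ r ^ 2)
  rw [← hv] at h1
  have h4 : 0 ≤ (r * l + r ^ 2 * ‖A‖ ^ 2 / 2) ^ 2 * ‖v‖ ^ 2 := by positivity
  change ‖v‖ ^ 2 + _ + _ ≤ _
  change _ ≤ 2 * r * (l * ‖v‖ ^ 2) at h1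
  nlinarith

/-- Since `M r = 1 + r A + o(r)`, the gap `l' - l` pays for the errors: half for the `o(r)` term,
half for the second-order term. -/
theorem eventually_norm_le_exp (A : Matrix S S ℝ) (M : ℝ → Matrix S S ℝ)
    (hM : HasDerivAt M A 0) (h0 : M 0 = 1) {l l' : ℝ} (hl : l < l')
    (hA : ∀ v : S → ℝ, v ⬝ᵥ (A *ᵥ v) ≤ l * (v ⬝ᵥ v)) :
    ∀ᶠ r in 𝓝[≥] (0 : ℝ), ‖M r‖ ≤ Real.exp (l' * r) := by
  have hc : 0 < (l' - l) / 2 := by linarith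
  have h1 := (hasDerivAt_iff_isLittleO.mp hM).def hc
  have h2 : ∀ᶠ r in 𝓝 (0 : ℝ), 0 < 1 + (r * l + r ^ 2 * ‖A‖ ^ 2 / 2) := by
    have : Continuous fun r : ℝ => 1 + (r * l + r ^ 2 * ‖A‖ ^ 2 / 2) := by fun_prop
    exact (this.tendsto 0).eventually (lt_mem_nhds (by simp))
  have h3 : ∀ᶠ r in 𝓝 (0 : ℝ), r * ‖A‖ ^ 2 / 2 < (l' - l) / 2 := by
    have : Continuous fun r : ℝ => r * ‖A‖ ^ 2 / 2 := by fun_prop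
    exact (this.tendsto 0).eventually (gt_mem_nhds (by simpa using hc))
  filter_upwards [nhdsWithin_le_nhds h1, nhdsWithin_le_nhds h2, nhdsWithin_le_nhds h3,
    self_mem_nhdsWithin] with r h1 h2 h3 (hr : 0 ≤ r)
  have h4 := norm_one_add_smul_le A l hA hr h2.le
  rw [h0, sub_zero, Real.norm_of_nonneg hr] at h1
  have h5 : ‖M r‖ ≤ ‖M r - 1 - r • A‖ + ‖1 + r • A‖ := by
    refine le_trans (le_of_eq ?_) (norm_add_le _ _)
    congr 1
    abel
  have h6 := mul_le_mul_of_nonneg_left h3.le hr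
  have h7 := Real.add_one_le_exp (l' * r)
  nlinarith

theorem sum_path_eq (M : Matrix S S ℝ) (k : ℕ) (g : S → ℝ) :
    ∑ a : Fin (k + 1) → S, g (a 0) * ∏ i : Fin k, M (a i.castSucc) (a i.succ) =
      g ⬝ᵥ ((M ^ k) *ᵥ 1) := by
  induction k generalizing g with
  | zero =>
    simp only [Finset.univ_eq_empty, Finset.prod_empty, mul_one, pow_zero, Matrix.one_mulVec,
      dotProduct_one]
    exact Fintype.sum_equiv (Equiv.funUnique (Fin 1) S) _ _ fun a => rfl
  | succ k ih =>
    rw [← (Fin.consEquiv fun _ => S).sum_comp, Fintype.sum_prod_type]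
    simp only [Fin.consEquiv, Equiv.coe_fn_mk, Fin.cons_zero, Fin.prod_univ_succ, Fin.castSucc_zero,
      Fin.cons_succ, ← Fin.succ_castSucc]
    refine Finset.sum_congr rfl fun b _ => ?_
    rw [← Finset.mul_sum]
    rw [ih (M b), pow_succ', ← Matrix.mulVec_mulVec]
    rfl

/-- Cauchy-Schwarz. A probability vector has `ℓ²` norm at most 1 because its entries are at most 1,
so no density bound on the initial law is required. -/
theorem dotProduct_pow_mulVec_le (M : Matrix S S ℝ) (k : ℕ) (p : S → ℝ) (hp : ∀ a, 0 ≤ p a)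
    (hp1 : ∑ a, p a = 1) :
    p ⬝ᵥ ((M ^ k) *ᵥ 1) ≤ ‖M‖ ^ k * √(Fintype.card S) := by
  have hp2 : ‖WithLp.toLp 2 p‖ ≤ 1 := by
    rw [EuclideanSpace.norm_eq, Real.sqrt_le_one]
    calc ∑ a, ‖p a‖ ^ 2 ≤ ∑ a, p a := by
          refine Finset.sum_le_sum fun a _ => ?_
          have : p a ≤ 1 := hp1 ▸ Finset.single_le_sum (fun b _ => hp b) (Finset.mem_univ a)
          rw [Real.norm_of_nonneg (hp a)]
          nlinarith [hp a]
      _ ≤ 1 := hp1.le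
  have hone : ‖WithLp.toLp 2 (1 : S → ℝ)‖ = √(Fintype.card S) := by
    rw [EuclideanSpace.norm_eq]; simp
  have h1 : p ⬝ᵥ ((M ^ k) *ᵥ 1) ≤ ‖WithLp.toLp 2 p‖ * ‖WithLp.toLp 2 ((M ^ k) *ᵥ 1)‖ := by
    refine le_trans (le_of_eq ?_) (real_inner_le_norm _ _)
    rw [EuclideanSpace.inner_toLp_toLp, dotProduct_comm]
    simp
  have h2 : ‖WithLp.toLp 2 ((M ^ k) *ᵥ 1)‖ ≤ ‖M ^ k‖ * ‖WithLp.toLp 2 (1 : S → ℝ)‖ :=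
    Matrix.l2_opNorm_mulVec (M ^ k) (WithLp.toLp 2 1)
  have h3 : ‖M ^ k‖ ≤ ‖M‖ ^ k := by
    cases isEmpty_or_nonempty S
    · simp at hp1
    · exact norm_pow_le M k
  calc _ ≤ 1 * ‖WithLp.toLp 2 ((M ^ k) *ᵥ 1)‖ := h1.trans (by gcongr)
    _ ≤ _ := by
      rw [one_mul, ← hone]
      exact h2.trans (by gcongr)

/-- A discrete Feynman-Kac bound. -/
theorem eventually_sum_path_exp_le (Q : Matrix S S ℝ) (U : S → ℝ) {l l' : ℝ} (hl : l < l')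
    (hQ : ∀ v : S → ℝ, v ⬝ᵥ (Q *ᵥ v) + ∑ a, U a * v a ^ 2 ≤ l * ∑ a, v a ^ 2)
    (p : S → ℝ) (hp : ∀ a, 0 ≤ p a) (hp1 : ∑ a, p a = 1) {t : ℝ} (ht : 0 ≤ t) :
    ∀ᶠ N : ℕ in atTop, ∑ a : Fin (N + 1) → S,
      p (a 0) * (∏ i : Fin N, NormedSpace.exp ((t / N) • Q) (a i.castSucc) (a i.succ)) *
        Real.exp (∑ i : Fin N, t / N * U (a i.succ)) ≤
      √(Fintype.card S) * Real.exp (l' * t) := by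
  -- One step of the split evolution. Path weights are exactly products of its entries, so only the
  -- bound `‖M (t / N)‖ ^ N ≤ exp (l' t)` is needed, not convergence of the Trotter product.
  let M : ℝ → Matrix S S ℝ := fun r =>
    NormedSpace.exp (r • Q) * NormedSpace.exp (r • Matrix.diagonal U)
  have hM : HasDerivAt M (Q + Matrix.diagonal U) 0 := by
    have h := (hasDerivAt_exp_smul_const (𝕂 := ℝ) Q 0).mul
      (hasDerivAt_exp_smul_const (𝕂 := ℝ) (Matrix.diagonal U) 0)
    have h' : HasDerivAt M _ 0 := h
    convert h' using 1
    simp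
  have hA : ∀ v : S → ℝ, v ⬝ᵥ ((Q + Matrix.diagonal U) *ᵥ v) ≤ l * (v ⬝ᵥ v) := fun v => by
    have h1 : v ⬝ᵥ (Matrix.diagonal U *ᵥ v) = ∑ a, U a * v a ^ 2 := by
      simp only [dotProduct, Matrix.mulVec_diagonal]
      exact Finset.sum_congr rfl fun a _ => by ring
    have h2 : v ⬝ᵥ v = ∑ a, v a ^ 2 := by simp [dotProduct, sq]
    rw [Matrix.add_mulVec, dotProduct_add, h1, h2]
    exact hQ v
  have hev := eventually_norm_le_exp _ M hM (by simp [M]) hl hA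
  have htend : Tendsto (fun N : ℕ => t / N) atTop (𝓝[≥] 0) :=
    tendsto_nhdsWithin_iff.mpr ⟨tendsto_const_div_atTop_nhds_zero_nat t,
      Eventually.of_forall fun N => div_nonneg ht (Nat.cast_nonneg N)⟩
  filter_upwards [htend.eventually hev, eventually_gt_atTop 0] with N hN hN0
  have hMab : ∀ a b, M (t / N) a b = NormedSpace.exp ((t / N) • Q) a b *
      Real.exp (t / N * U b) := fun a b => by
    have : (t / N) • Matrix.diagonal U = Matrix.diagonal fun a => t / N * U a := by
      ext i j
      simp [Matrix.diagonal_apply]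
    simp only [M, this, Matrix.exp_diagonal, Matrix.mul_diagonal, Pi.coe_exp, Real.exp_eq_exp_ℝ]
  calc _ = ∑ a : Fin (N + 1) → S, p (a 0) * ∏ i : Fin N, M (t / N) (a i.castSucc) (a i.succ) := by
        refine Finset.sum_congr rfl fun a _ => ?_
        rw [Real.exp_sum, mul_assoc, ← Finset.prod_mul_distrib]
        simp only [hMab]
    _ ≤ ‖M (t / N)‖ ^ N * √(Fintype.card S) := by
        rw [sum_path_eq]
        exact dotProduct_pow_mulVec_le _ _ _ hp hp1
    _ ≤ Real.exp (l' * (t / N)) ^ N * √(Fintype.card S) := by gcongr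
    _ = _ := by
        rw [← Real.exp_nat_mul, mul_comm]
        congr 2
        field_simp

end Trotter

/-! ### Quadratic form of the generator -/

theorem exchange_exchange {n : ℕ+} (x y : Site n) (η : Config n) :
    exchange x y (exchange x y η) = η := by
  funext z; simp [exchange]

theorem exchange_comm {n : ℕ+} (x y : Site n) : exchange x y = exchange (n := n) y x := by
  funext η z; simp [exchange, Equiv.swap_comm]

theorem sum_exchange {n : ℕ+} (x y : Site n) (g : Config n → ℝ) :
    ∑ η, g (exchange x y η) = ∑ η, g η :=
  Equiv.sum_comp (Function.Involutive.toPerm _ (exchange_exchange x y)) g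

/-- The Dirichlet form of the exclusion process, up to a constant. -/
def bondEnergy {n : ℕ+} (u : Config n → ℝ) : ℝ :=
  ∑ x : Site n, ∑ η, (u (exchange x (x + 1) η) - u η) ^ 2

theorem generator_add (n : ℕ+) (c : ℤˣ → ZConfig → ℝ) (g g' : State n → ℝ) (a : State n) :
    generator n c (g + g') a = generator n c g a + generator n c g' a := by
  have h1 : ∀ x y : Site n, (if Neighbours x y then
      (g + g') (exchange x y a.1, a.2) - (g + g') a else 0) =
      (if Neighbours x y then g (exchange x y a.1, a.2) - g a else 0) +
      (if Neighbours x y then g' (exchange x y a.1, a.2) - g' a else 0) := fun x y => by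
    split_ifs
    · simp only [Pi.add_apply]; ring
    · simp
  have h2 : ∀ z : ℤˣ, lift n (c z) (shift a.2 a.1) *
      ((g + g') (a.1, a.2 + ((z : ℤ) : Site n)) - (g + g') a) =
      lift n (c z) (shift a.2 a.1) * (g (a.1, a.2 + ((z : ℤ) : Site n)) - g a) +
      lift n (c z) (shift a.2 a.1) * (g' (a.1, a.2 + ((z : ℤ) : Site n)) - g' a) :=
    fun z => by simp only [Pi.add_apply]; ring
  simp only [generator, h1, h2, Finset.sum_add_distrib]
  ring

theorem generator_smul (n : ℕ+) (c : ℤˣ → ZConfig → ℝ) (r : ℝ) (g : State n → ℝ) (a : State n) :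
    generator n c (r • g) a = r * generator n c g a := by
  have h1 : ∀ x y : Site n, (if Neighbours x y then
      (r • g) (exchange x y a.1, a.2) - (r • g) a else 0) =
      r * (if Neighbours x y then g (exchange x y a.1, a.2) - g a else 0) := fun x y => by
    split_ifs
    · simp only [Pi.smul_apply, smul_eq_mul]; ring
    · simp
  have h2 : ∀ z : ℤˣ, lift n (c z) (shift a.2 a.1) *
      ((r • g) (a.1, a.2 + ((z : ℤ) : Site n)) - (r • g) a) =
      r * (lift n (c z) (shift a.2 a.1) * (g (a.1, a.2 + ((z : ℤ) : Site n)) - g a)) :=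
    fun z => by simp only [Pi.smul_apply, smul_eq_mul]; ring
  simp only [generator, h1, h2, ← Finset.mul_sum]
  ring

theorem rateMatrix_mulVec (n : ℕ+) (c : ℤˣ → ZConfig → ℝ) (v : State n → ℝ) (a : State n) :
    (rateMatrix n c).mulVec v a = generator n c v a := by
  let G : (State n → ℝ) →ₗ[ℝ] ℝ := IsLinearMap.mk' (fun g => generator n c g a)
    ⟨fun g g' => generator_add n c g g' a, fun r g => generator_smul n c r g a⟩
  have hG : ∀ g, G g = generator n c g a := fun g => rfl
  rw [← hG, pi_eq_sum_univ' v, map_sum]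
  simp only [Matrix.mulVec, dotProduct, rateMatrix, Matrix.of_apply, hG, generator_smul]
  refine Finset.sum_congr rfl fun b _ => ?_
  rw [← pi_eq_sum_univ' v, mul_comm]

/-- Integration by parts: an exchange is an involution preserving the counting measure, so both
squares in the expansion have the same sum. -/
theorem sum_mul_exchange_sub {n : ℕ+} (x y : Site n) (u : Config n → ℝ) :
    ∑ η, u η * (u (exchange x y η) - u η) =
      -(1 / 2) * ∑ η, (u (exchange x y η) - u η) ^ 2 := by
  have h := sum_exchange x y fun η => u η ^ 2
  have h2 : ∑ η, (u (exchange x y η) - u η) ^ 2 = ∑ η, u (exchange x y η) ^ 2 - ∑ η, u η ^ 2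
      - 2 * ∑ η, u η * (u (exchange x y η) - u η) := by
    rw [Finset.mul_sum, ← Finset.sum_sub_distrib, ← Finset.sum_sub_distrib]
    exact Finset.sum_congr rfl fun η _ => by ring
  rw [h2, h]
  ring

theorem site_one_ne_zero {n : ℕ+} (hn : 2 ≤ (n : ℕ)) : (1 : Site n) ≠ 0 := by
  have : Fact (1 < (n : ℕ)) := ⟨hn⟩
  exact one_ne_zero

/-- Only `y = x + 1` is kept among nonnegative terms; for `n ≥ 2` this is a genuine neighbour. -/
theorem bondEnergy_le_sum_neighbours {n : ℕ+} (hn : 2 ≤ (n : ℕ)) (u : Config n → ℝ) :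
    bondEnergy u ≤ ∑ x : Site n, ∑ y : Site n,
      if Neighbours x y then ∑ η, (u (exchange x y η) - u η) ^ 2 else 0 := by
  refine Finset.sum_le_sum fun x _ => ?_
  have h := Finset.single_le_sum (f := fun y : Site n =>
    if Neighbours x y then ∑ η, (u (exchange x y η) - u η) ^ 2 else 0)
    (fun y _ => by split_ifs; exacts [Finset.sum_nonneg fun _ _ => sq_nonneg _, le_rfl])
    (Finset.mem_univ (x + 1))
  rwa [if_pos] at h
  exact ⟨by simpa using site_one_ne_zero hn, Or.inl rfl⟩

theorem sum_exclusion_le {n : ℕ+} (hn : 2 ≤ (n : ℕ)) (u : Config n → ℝ) :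
    ∑ η, u η * ((1 / 2) * ∑ x : Site n, ∑ y : Site n,
      if Neighbours x y then u (exchange x y η) - u η else 0) ≤ -(1 / 4) * bondEnergy u := by
  have h : ∑ η, u η * ((1 / 2) * ∑ x : Site n, ∑ y : Site n,
      if Neighbours x y then u (exchange x y η) - u η else 0) =
      -(1 / 4) * ∑ x : Site n, ∑ y : Site n,
      if Neighbours x y then ∑ η, (u (exchange x y η) - u η) ^ 2 else 0 := by
    simp only [Finset.mul_sum]
    rw [Finset.sum_comm]
    refine Finset.sum_congr rfl fun x _ => ?_
    rw [Finset.sum_comm]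
    refine Finset.sum_congr rfl fun y _ => ?_
    split_ifs
    · have := sum_mul_exchange_sub x y u
      calc _ = (1 / 2) * ∑ η, u η * (u (exchange x y η) - u η) := by
            rw [Finset.mul_sum]; exact Finset.sum_congr rfl fun η _ => by ring
        _ = _ := by rw [this]; ring
    · simp
  rw [h]
  have := bondEnergy_le_sum_neighbours hn u
  linarith

/-- For a rate `q ∈ [0, K]`, `q v (w - v) ≤ q (w² - v²)/2 ≤ K w²/2`. Translating the walker permutes
the states, so each of the two directions contributes at most `(K/2) ∑ v²`. -/
theorem sum_walk_le {n : ℕ+} {c : ℤˣ → ZConfig → ℝ} (hc : ∀ z η, 0 ≤ c z η) {K : ℝ}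
    (hK : ∀ z η, c z η ≤ K) (v : State n → ℝ) :
    ∑ a, v a * ∑ z : ℤˣ, lift n (c z) (shift a.2 a.1) *
      (v (a.1, a.2 + ((z : ℤ) : Site n)) - v a) ≤ K * ∑ a, v a ^ 2 := by
  have h1 : ∀ a : State n, v a * ∑ z : ℤˣ, lift n (c z) (shift a.2 a.1) *
      (v (a.1, a.2 + ((z : ℤ) : Site n)) - v a) ≤
      ∑ z : ℤˣ, K / 2 * v (a.1, a.2 + ((z : ℤ) : Site n)) ^ 2 := fun a => by
    rw [Finset.mul_sum]
    refine Finset.sum_le_sum fun z _ => ?_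
    have h0 : 0 ≤ lift n (c z) (shift a.2 a.1) := hc z _
    have hk : lift n (c z) (shift a.2 a.1) ≤ K := hK z _
    set q := lift n (c z) (shift a.2 a.1)
    set w := v (a.1, a.2 + ((z : ℤ) : Site n))
    nlinarith [mul_nonneg h0 (sq_nonneg (w - v a)), mul_nonneg h0 (sq_nonneg (v a)),
      mul_nonneg (sub_nonneg.2 hk) (sq_nonneg w)]
  refine (Finset.sum_le_sum fun a _ => h1 a).trans ?_
  rw [Finset.sum_comm]
  have h2 : ∀ z : ℤˣ, ∑ a : State n, K / 2 * v (a.1, a.2 + ((z : ℤ) : Site n)) ^ 2 =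
      K / 2 * ∑ a, v a ^ 2 := fun z => by
    rw [← Finset.mul_sum]
    congr 1
    exact Equiv.sum_comp ((Equiv.refl _).prodCongr (Equiv.addRight ((z : ℤ) : Site n)))
      fun a => v a ^ 2
  simp only [h2]
  rw [Finset.sum_const, Finset.card_univ, Fintype.card_units_int]
  simp only [nsmul_eq_mul]
  push_cast
  linarith

theorem dotProduct_rateMatrix_le {n : ℕ+} (hn : 2 ≤ (n : ℕ)) {c : ℤˣ → ZConfig → ℝ}
    (hc : ∀ z η, 0 ≤ c z η) {K : ℝ} (hK : ∀ z η, c z η ≤ K) (v : State n → ℝ) :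
    v ⬝ᵥ (rateMatrix n c).mulVec v ≤
      n * K * ∑ a, v a ^ 2 - (n : ℝ) ^ 2 / 4 * ∑ x, bondEnergy fun η => v (η, x) := by
  have h1 : v ⬝ᵥ (rateMatrix n c).mulVec v =
      (n : ℝ) ^ 2 * ∑ x : Site n, ∑ η, v (η, x) * ((1 / 2) * ∑ y : Site n, ∑ z : Site n,
        if Neighbours y z then v (exchange y z η, x) - v (η, x) else 0) +
      n * ∑ a, v a * ∑ z : ℤˣ, lift n (c z) (shift a.2 a.1) *
      (v (a.1, a.2 + ((z : ℤ) : Site n)) - v a) := by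
    rw [← Fintype.sum_prod_type_right' (f := fun η x => v (η, x) * ((1 / 2) * ∑ y : Site n, ∑ z : Site n,
        if Neighbours y z then v (exchange y z η, x) - v (η, x) else 0)), Finset.mul_sum,
      Finset.mul_sum, ← Finset.sum_add_distrib]
    refine Finset.sum_congr rfl fun a _ => ?_
    rw [rateMatrix_mulVec, generator]
    ring
  have h2 : ∀ x : Site n, ∑ η, v (η, x) * ((1 / 2) * ∑ y : Site n, ∑ z : Site n,
        if Neighbours y z then v (exchange y z η, x) - v (η, x) else 0) ≤
      -(1 / 4) * bondEnergy fun η => v (η, x) := fun x => sum_exclusion_le hn fun η => v (η, x)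
  have h3 := Finset.sum_le_sum fun x (_ : x ∈ Finset.univ) => h2 x
  rw [← Finset.mul_sum] at h3
  have h4 := mul_le_mul_of_nonneg_left h3 (sq_nonneg (n : ℝ))
  have h5 := mul_le_mul_of_nonneg_left (sum_walk_le hc hK v) (Nat.cast_nonneg (α := ℝ) (n : ℕ))
  rw [h1]
  linarith

theorem IsLocal.exists_le {f : ZConfig → ℝ} (hf : IsLocal f) : ∃ K, ∀ η, f η ≤ K := by
  classical
  obtain ⟨A, hA⟩ := hf
  obtain ⟨K, hK⟩ := (Set.finite_range fun σ : A → Bool =>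
    f fun z => if h : z ∈ A then σ ⟨z, h⟩ else false).bddAbove
  refine ⟨K, fun η => ?_⟩
  have : f η = f fun z => if h : z ∈ A then (fun a : A => η a) ⟨z, h⟩ else false :=
    hA fun z hz => by simp [Finset.mem_coe.mp hz]
  rw [this]
  exact hK ⟨fun a : A => η a, rfl⟩

/-! ### Cost of exchanging distant sites -/

section Path

variable {n : ℕ+}

/-- The `ℓ²` distance between `u` and `u` composed with an exchange. -/
def exchangeDist (u : Config n → ℝ) (x y : Site n) : ℝ :=
  ‖WithLp.toLp 2 fun η => u (exchange x y η) - u η‖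

theorem exchangeDist_sq (u : Config n → ℝ) (x y : Site n) :
    exchangeDist u x y ^ 2 = ∑ η, (u (exchange x y η) - u η) ^ 2 := by
  rw [exchangeDist, EuclideanSpace.real_norm_sq_eq]

theorem norm_comp_exchange (w : Config n → ℝ) (x y : Site n) :
    ‖WithLp.toLp 2 fun η => w (exchange x y η)‖ = ‖WithLp.toLp 2 w‖ := by
  rw [EuclideanSpace.norm_eq, EuclideanSpace.norm_eq]
  congr 1
  exact sum_exchange x y fun η => ‖w η‖ ^ 2

/-- A transposition is a conjugate, `(x z) = (y z)(x y)(y z)`, and composing with an exchange is an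
`ℓ²` isometry. Telescoping through the three exchanges uses `(y z)` twice. -/
theorem exchangeDist_triangle (u : Config n → ℝ) {x y z : Site n} (hxy : x ≠ y) (hxz : x ≠ z) :
    exchangeDist u x z ≤ exchangeDist u x y + 2 * exchangeDist u y z := by
  have h : ∀ η, exchange x z η = exchange y z (exchange x y (exchange y z η)) := fun η => by
    funext w
    have := Equiv.congr_fun (Equiv.swap_mul_swap_mul_swap hxy hxz) w
    simp only [Equiv.Perm.coe_mul, Function.comp_apply] at this
    simp only [exchange, this, Equiv.swap_comm]
  have h2 : (WithLp.toLp 2 fun η => u (exchange x z η) - u η) =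
      (WithLp.toLp 2 fun η => u (exchange y z (exchange x y (exchange y z η))) -
        u (exchange x y (exchange y z η))) +
      (WithLp.toLp 2 fun η => u (exchange x y (exchange y z η)) - u (exchange y z η)) +
      WithLp.toLp 2 fun η => u (exchange y z η) - u η := by
    ext η
    simp only [PiLp.add_apply, h]
    ring
  have h3 := norm_comp_exchange (fun η => u (exchange x y η) - u η) y z
  have h4 := norm_comp_exchange (fun η => u (exchange y z (exchange x y η)) -
        u (exchange x y η)) y z
  have h5 := norm_comp_exchange (fun η => u (exchange y z η) - u η) x y
  rw [exchangeDist, h2]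
  refine (norm_add₃_le).trans ?_
  rw [h3, h4, h5, exchangeDist, exchangeDist]
  linarith

theorem exchangeDist_self (u : Config n → ℝ) (x : Site n) : exchangeDist u x x = 0 := by
  have : ∀ η : Config n, exchange x x η = η := fun η => by funext z; simp [exchange]
  simp only [exchangeDist, this, sub_self]
  exact norm_zero

theorem site_natCast_inj {i j : ℕ} (hi : i < n) (hj : j < n) (h : (i : Site n) = j) : i = j := by
  rwa [ZMod.natCast_eq_natCast_iff', Nat.mod_eq_of_lt hi, Nat.mod_eq_of_lt hj] at h

theorem exchangeDist_le_sum (u : Config n → ℝ) (x : Site n) (d : ℕ) (hd : d < n) :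
    exchangeDist u x (x + d) ≤ 2 * ∑ j ∈ Finset.range d, exchangeDist u (x + j) (x + j + 1) := by
  have hne : ∀ k : ℕ, 0 < k → k < n → x ≠ x + (k : Site n) := fun k hk hkn h => by
    have h0 : (k : Site n) = (0 : ℕ) := by simpa using h
    exact hk.ne' (site_natCast_inj hkn n.pos h0)
  induction d with
  | zero => simp [exchangeDist_self]
  | succ d ih =>
    rw [Finset.sum_range_succ]
    rcases Nat.eq_zero_or_pos d with rfl | hd0
    · have : 0 ≤ exchangeDist u x (x + 1) := norm_nonneg _
      simp
      linarith
    · have h := exchangeDist_triangle u (hne d hd0 (by omega)) (hne (d + 1) (by omega) hd)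
      have h' := ih (by omega)
      push_cast at h ⊢
      rw [← add_assoc] at h ⊢
      linarith

/-- Cauchy-Schwarz over the `d` bonds of the path gives the factor `d`; the `4` is the square of the
`2` from conjugation. Since `d < n` the bonds are distinct, so their energies add up to at most the
total. -/
theorem sum_sq_exchange_sub_le (u : Config n → ℝ) (x : Site n) (d : ℕ) (hd : d < n) :
    ∑ η, (u (exchange x (x + d) η) - u η) ^ 2 ≤ 4 * d * bondEnergy u := by
  have h1 := exchangeDist_le_sum u x d hd
  have h0 : 0 ≤ exchangeDist u x (x + d) := norm_nonneg _
  have h2 : (∑ j ∈ Finset.range d, exchangeDist u (x + j) (x + j + 1)) ^ 2 ≤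
      d * ∑ j ∈ Finset.range d, exchangeDist u (x + j) (x + j + 1) ^ 2 := by
    simpa using sq_sum_le_card_mul_sum_sq (s := Finset.range d)
      (f := fun j : ℕ => exchangeDist u (x + j) (x + j + 1))
  have h3 : ∑ j ∈ Finset.range d, exchangeDist u (x + j) (x + j + 1) ^ 2 ≤ bondEnergy u := by
    simp only [bondEnergy, ← exchangeDist_sq]
    rw [← Finset.sum_image (f := fun y : Site n => exchangeDist u y (y + 1) ^ 2)
      (g := fun j : ℕ => x + (j : Site n))]
    · exact Finset.sum_le_sum_of_subset_of_nonneg (Finset.subset_univ _) fun _ _ _ => sq_nonneg _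
    · intro i hi j hj hij
      simp only [Finset.coe_range, mem_Iio] at hi hj
      exact site_natCast_inj (hi.trans hd) (hj.trans hd) (add_left_cancel hij)
  rw [← exchangeDist_sq]
  calc _ ≤ (2 * ∑ j ∈ Finset.range d, exchangeDist u (x + j) (x + j + 1)) ^ 2 := by gcongr
    _ = 4 * (∑ j ∈ Finset.range d, exchangeDist u (x + j) (x + j + 1)) ^ 2 := by ring
    _ ≤ 4 * (d * bondEnergy u) := by
      have := mul_le_mul_of_nonneg_left h3 (Nat.cast_nonneg (α := ℝ) d)
      linarith
    _ = _ := by ring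

/-- Factor `|p² - q²| = |p - q| |p + q|` and apply Young's inequality with weight `θ`, chosen later
to balance energy against mass. -/
theorem sum_abs_sq_exchange_sub_le (u : Config n → ℝ) (x y : Site n) {θ : ℝ} (hθ : 0 < θ) :
    ∑ η, |u (exchange x y η) ^ 2 - u η ^ 2| ≤
      1 / (2 * θ) * ∑ η, (u (exchange x y η) - u η) ^ 2 + 2 * θ * ∑ η, u η ^ 2 := by
  have h := sum_exchange x y fun η => u η ^ 2
  have h2 : 2 * θ * ∑ η, u η ^ 2 = θ * ∑ η, (u (exchange x y η) ^ 2 + u η ^ 2) := by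
    rw [Finset.sum_add_distrib, h]; ring
  rw [h2, Finset.mul_sum, Finset.mul_sum, ← Finset.sum_add_distrib]
  refine Finset.sum_le_sum fun η _ => ?_
  set p := u (exchange x y η)
  set q := u η
  have h3 : |p ^ 2 - q ^ 2| = |p - q| * |p + q| := by rw [← abs_mul]; congr 1; ring
  have h4 : 1 / (2 * θ) * (p - q) ^ 2 = (|p - q| / θ) ^ 2 * θ / 2 := by
    rw [div_pow, sq_abs]; field_simp
  have h5 : |p - q| * |p + q| = (|p - q| / θ) * |p + q| * θ := by field_simp
  have h6 : (p + q) ^ 2 ≤ 2 * (p ^ 2 + q ^ 2) := by nlinarith [sq_nonneg (p - q)]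
  rw [h3, h4, h5]
  nlinarith [mul_nonneg hθ.le (sq_nonneg (|p - q| / θ - |p + q|)), sq_abs (p + q)]

end Path

theorem abs_prod_sub_prod_le {ι : Type*} (A : Finset ι) (F G : ι → ℝ)
    (hF : ∀ a ∈ A, F a ∈ Icc (0 : ℝ) 1) (hG : ∀ a ∈ A, G a ∈ Icc (0 : ℝ) 1) :
    |∏ a ∈ A, F a - ∏ a ∈ A, G a| ≤ ∑ a ∈ A, |F a - G a| := by
  classical
  induction A using Finset.induction_on with
  | empty => simp
  | insert b A hb ih =>
    rw [Finset.prod_insert hb, Finset.prod_insert hb, Finset.sum_insert hb]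
    have h1 := ih (fun a ha => hF a (Finset.mem_insert_of_mem ha))
      (fun a ha => hG a (Finset.mem_insert_of_mem ha))
    have hFb := hF b (Finset.mem_insert_self b A)
    have h2 : |∏ a ∈ A, G a| ≤ 1 := by
      rw [Finset.abs_prod]
      refine Finset.prod_le_one (fun _ _ => abs_nonneg _) fun a ha => ?_
      have := hG a (Finset.mem_insert_of_mem ha)
      rw [abs_of_nonneg this.1]
      exact this.2
    have h3 : F b * ∏ a ∈ A, F a - G b * ∏ a ∈ A, G a =
        F b * (∏ a ∈ A, F a - ∏ a ∈ A, G a) + (F b - G b) * ∏ a ∈ A, G a := by ring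
    rw [h3]
    refine (abs_add_le _ _).trans ?_
    rw [abs_mul, abs_mul, abs_of_nonneg hFb.1]
    nlinarith [mul_le_mul_of_nonneg_left h2 (abs_nonneg (F b - G b)),
      mul_le_mul_of_nonneg_right hFb.2 (abs_nonneg (∏ a ∈ A, F a - ∏ a ∈ A, G a))]

/-! ### Replacing site values by weighted averages -/

section Replacement

variable {n : ℕ+} (w : Site n → ℝ)

/-- The average of `φ (ξ y)` over the sites `y`, with weights `w`. -/
def siteAverage (φ : Bool → ℝ) (ξ : Config n) : ℝ := ∑ y, w y * φ (ξ y)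

variable {w} {κ : ℝ} {φ : Bool → ℝ}

theorem siteAverage_mem (hw : ∀ y, 0 ≤ w y) (hw1 : ∑ y, w y = 1)
    (hφ : ∀ v, φ v ∈ Icc (0 : ℝ) 1) (ξ : Config n) : siteAverage w φ ξ ∈ Icc (0 : ℝ) 1 := by
  refine ⟨Finset.sum_nonneg fun y _ => mul_nonneg (hw y) (hφ _).1, ?_⟩
  rw [← hw1]
  exact Finset.sum_le_sum fun y _ => mul_le_of_le_one_right (hw y) (hφ _).2

theorem abs_siteAverage_exchange_sub_le (hw : ∀ y, 0 ≤ w y) (hκ : ∀ y, w y ≤ κ)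
    (hφ : ∀ v, φ v ∈ Icc (0 : ℝ) 1) (x y : Site n) (ξ : Config n) :
    |siteAverage w φ (exchange x y ξ) - siteAverage w φ ξ| ≤ 2 * κ := by
  have hκ0 : 0 ≤ κ := (hw x).trans (hκ x)
  have h : ∀ z, |w z * φ (exchange x y ξ z) - w z * φ (ξ z)| ≤
      (if z = x then κ else 0) + (if z = y then κ else 0) := fun z => by
    by_cases hz : z = x ∨ z = y
    · have h1 : |φ (exchange x y ξ z) - φ (ξ z)| ≤ 1 := by
        have h2 := hφ (exchange x y ξ z)
        have h3 := hφ (ξ z)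
        rw [abs_le]
        constructor <;> linarith [h2.1, h2.2, h3.1, h3.2]
      rw [← mul_sub, abs_mul, abs_of_nonneg (hw z)]
      refine (mul_le_of_le_one_right (hw z) h1).trans ((hκ z).trans ?_)
      rcases hz with rfl | rfl
      · rw [if_pos rfl]; split_ifs <;> linarith
      · rw [if_pos (c := z = z) rfl]; split_ifs <;> linarith
    · push Not at hz
      have : exchange x y ξ z = ξ z := by
        simp [exchange, Equiv.swap_apply_of_ne_of_ne hz.1 hz.2]
      rw [this, sub_self, abs_zero, if_neg hz.1, if_neg hz.2, add_zero]
  rw [siteAverage, siteAverage, ← Finset.sum_sub_distrib]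
  refine (Finset.abs_sum_le_sum_abs _ _).trans ((Finset.sum_le_sum fun z _ => h z).trans ?_)
  rw [Finset.sum_add_distrib]
  simp
  linarith

/-- Exchanging `b` and `y` turns `φ (ξ y)` into `φ (ξ b)`. After this change of variables the
difference survives only through the variation of `G` and of `u²` under the exchange, averaged over
`y` with weight `w`. -/
theorem abs_sum_mul_sub_siteAverage_le (hw : ∀ y, 0 ≤ w y) (hw1 : ∑ y, w y = 1)
    (hφ : ∀ v, φ v ∈ Icc (0 : ℝ) 1) (b : Site n) (u G : Config n → ℝ) (hG : ∀ ξ, |G ξ| ≤ 1)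
    (r : Site n → ℝ) (hr : ∀ y ξ, |G (exchange b y ξ) - G ξ| ≤ r y) {Γ : ℝ}
    (hΓ : ∀ y, w y ≠ 0 → ∑ ξ, |u (exchange b y ξ) ^ 2 - u ξ ^ 2| ≤ Γ) :
    |∑ ξ, G ξ * (φ (ξ b) - siteAverage w φ ξ) * u ξ ^ 2| ≤
      (∑ y, w y * r y) * ∑ ξ, u ξ ^ 2 + Γ := by
  have h1 : ∑ ξ, G ξ * (φ (ξ b) - siteAverage w φ ξ) * u ξ ^ 2 =
      ∑ y, w y * ∑ ξ, G ξ * (φ (ξ b) - φ (ξ y)) * u ξ ^ 2 := by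
    simp only [Finset.mul_sum]
    rw [Finset.sum_comm]
    refine Finset.sum_congr rfl fun ξ _ => ?_
    have : φ (ξ b) - siteAverage w φ ξ = ∑ y, w y * (φ (ξ b) - φ (ξ y)) := by
      simp only [mul_sub, Finset.sum_sub_distrib, ← Finset.sum_mul, hw1, one_mul, siteAverage]
    rw [this, Finset.mul_sum, Finset.sum_mul]
    exact Finset.sum_congr rfl fun y _ => by ring
  have h2 : ∀ y, ∑ ξ, G ξ * (φ (ξ b) - φ (ξ y)) * u ξ ^ 2 =
      ∑ ξ, φ (ξ b) * ((G ξ - G (exchange b y ξ)) * u ξ ^ 2 +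
        G (exchange b y ξ) * (u ξ ^ 2 - u (exchange b y ξ) ^ 2)) := fun y => by
    have h3 := sum_exchange b y fun ξ => G ξ * φ (ξ y) * u ξ ^ 2
    have h4 : ∀ ξ : Config n, exchange b y ξ y = ξ b := fun ξ => by simp [exchange]
    simp only [h4] at h3
    calc _ = ∑ ξ, G ξ * φ (ξ b) * u ξ ^ 2 - ∑ ξ, G ξ * φ (ξ y) * u ξ ^ 2 := by
          rw [← Finset.sum_sub_distrib]
          exact Finset.sum_congr rfl fun ξ _ => by ring
      _ = _ := by
          rw [← h3, ← Finset.sum_sub_distrib]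
          exact Finset.sum_congr rfl fun ξ _ => by ring
  have h5 : ∀ y, w y ≠ 0 → |∑ ξ, G ξ * (φ (ξ b) - φ (ξ y)) * u ξ ^ 2| ≤
      r y * ∑ ξ, u ξ ^ 2 + Γ := fun y hy => by
    rw [h2]
    refine (Finset.abs_sum_le_sum_abs _ _).trans ?_
    refine le_trans ?_ (add_le_add_right (hΓ y hy) _)
    rw [Finset.mul_sum, ← Finset.sum_add_distrib]
    refine Finset.sum_le_sum fun ξ _ => ?_
    rw [abs_mul, abs_of_nonneg (hφ _).1]
    refine (mul_le_of_le_one_left (abs_nonneg _) (hφ _).2).trans ((abs_add_le _ _).trans ?_)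
    rw [abs_mul, abs_mul, abs_sub_comm (G ξ), abs_of_nonneg (sq_nonneg (u ξ)),
      abs_sub_comm (u ξ ^ 2)]
    exact add_le_add (mul_le_mul_of_nonneg_right (hr y ξ) (sq_nonneg _))
      (mul_le_of_le_one_left (abs_nonneg _) (hG _))
  rw [h1]
  refine (Finset.abs_sum_le_sum_abs _ _).trans ?_
  have h6 : (∑ y, w y * r y) * ∑ ξ, u ξ ^ 2 + Γ =
      ∑ y, w y * (r y * ∑ ξ, u ξ ^ 2 + Γ) := by
    simp only [mul_add, Finset.sum_add_distrib, ← Finset.sum_mul, hw1, one_mul, ← mul_assoc]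
  rw [h6]
  refine Finset.sum_le_sum fun y _ => ?_
  rw [abs_mul, abs_of_nonneg (hw y)]
  by_cases hy : w y = 0
  · simp [hy]
  · exact mul_le_mul_of_nonneg_left (h5 y hy) (hw y)

/-- The factors of a product function can be replaced by their averages. -/
theorem abs_sum_prod_sub_prod_siteAverage_le {ι : Type*} (A : Finset ι) (p : ι → Site n)
    (hp : InjOn p A) (φ : ι → Bool → ℝ) (hφ : ∀ i v, φ i v ∈ Icc (0 : ℝ) 1)
    (hw : ∀ y, 0 ≤ w y) (hw1 : ∑ y, w y = 1) (hκ : ∀ y, w y ≤ κ) (u : Config n → ℝ) {Γ : ℝ}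
    (hΓ : ∀ b ∈ A, ∀ y, w y ≠ 0 → ∑ ξ, |u (exchange (p b) y ξ) ^ 2 - u ξ ^ 2| ≤ Γ) :
    |∑ ξ, (∏ a ∈ A, φ a (ξ (p a)) - ∏ a ∈ A, siteAverage w (φ a) ξ) * u ξ ^ 2| ≤
      A.card * (3 * κ * A.card * ∑ ξ, u ξ ^ 2 + Γ) := by
  classical
  have hκ0 : 0 ≤ κ := (hw 0).trans (hκ 0)
  -- Hybrid factors: those indexed by `B` are already averaged. Induction on `B` replaces one factor
  -- at a time.
  let ψ : Finset ι → ι → Config n → ℝ := fun B a ξ =>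
    if a ∈ B then siteAverage w (φ a) ξ else φ a (ξ (p a))
  have hψ : ∀ B a ξ, ψ B a ξ ∈ Icc (0 : ℝ) 1 := fun B a ξ => by
    simp only [ψ]
    split_ifs
    · exact siteAverage_mem hw hw1 (hφ a) ξ
    · exact hφ a _
  -- An averaged factor moves by at most `2κ`. An untouched factor moves only if `y` is its own
  -- site, since injectivity of `p` keeps it away from `p b`.
  have hψs : ∀ B, ∀ b ∈ A, ∀ a ∈ A.erase b, ∀ y ξ,
      |ψ B a (exchange (p b) y ξ) - ψ B a ξ| ≤ 2 * κ + if y = p a then 1 else 0 := by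
    intro B b hb a ha y ξ
    rw [Finset.mem_erase] at ha
    simp only [ψ]
    split_ifs with h1 h2 h2
    · have := abs_siteAverage_exchange_sub_le hw hκ (hφ a) (p b) y ξ
      linarith
    · have := abs_siteAverage_exchange_sub_le hw hκ (hφ a) (p b) y ξ
      linarith
    · have h3 := hφ a (exchange (p b) y ξ (p a))
      have h4 := hφ a (ξ (p a))
      rw [abs_le]
      constructor <;> linarith [h3.1, h3.2, h4.1, h4.2]
    · have h5 : p a ≠ p b := fun h => ha.1 (hp ha.2 hb h)
      have : exchange (p b) y ξ (p a) = ξ (p a) := by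
        simp [exchange, Equiv.swap_apply_of_ne_of_ne h5 (Ne.symm h2)]
      rw [this, sub_self, abs_zero]
      linarith
  have key : ∀ B ⊆ A, |∑ ξ, (∏ a ∈ A, φ a (ξ (p a)) - ∏ a ∈ A, ψ B a ξ) * u ξ ^ 2| ≤
      B.card * (3 * κ * A.card * ∑ ξ, u ξ ^ 2 + Γ) := by
    intro B
    induction B using Finset.induction_on with
    | empty => intro _; simp [ψ]
    | insert b B hb ih =>
      intro hBA
      have hbA : b ∈ A := hBA (Finset.mem_insert_self b B)
      have ih' := ih ((Finset.subset_insert b B).trans hBA)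
      let G : Config n → ℝ := fun ξ => ∏ a ∈ A.erase b, ψ B a ξ
      have hstep : ∀ ξ, ∏ a ∈ A, ψ B a ξ - ∏ a ∈ A, ψ (insert b B) a ξ =
          G ξ * (φ b (ξ (p b)) - siteAverage w (φ b) ξ) := fun ξ => by
        rw [← Finset.mul_prod_erase A _ hbA, ← Finset.mul_prod_erase A _ hbA]
        have h1 : ∏ a ∈ A.erase b, ψ (insert b B) a ξ = G ξ := by
          refine Finset.prod_congr rfl fun a ha => ?_
          simp [ψ, Finset.ne_of_mem_erase ha]
        rw [h1]
        simp only [ψ, hb, if_false, Finset.mem_insert_self, if_true, G]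
        ring
      have hG : ∀ ξ, |G ξ| ≤ 1 := fun ξ => by
        rw [Finset.abs_prod]
        refine Finset.prod_le_one (fun _ _ => abs_nonneg _) fun a _ => ?_
        rw [abs_of_nonneg (hψ B a ξ).1]
        exact (hψ B a ξ).2
      have hr : ∀ y ξ, |G (exchange (p b) y ξ) - G ξ| ≤
          ∑ a ∈ A.erase b, (2 * κ + if y = p a then 1 else 0) := fun y ξ =>
        (abs_prod_sub_prod_le _ _ _ (fun a _ => hψ B a _) fun a _ => hψ B a ξ).trans
          (Finset.sum_le_sum fun a ha => hψs B b hbA a ha y ξ)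
      have hone := abs_sum_mul_sub_siteAverage_le hw hw1 (hφ b) (p b) u G hG _ hr (hΓ b hbA)
      -- Under the weights `w`, the coincidence `y = p a` has mass `w (p a) ≤ κ`; hence `2κ + κ` per
      -- factor.
      have hsum : ∑ y, w y * ∑ a ∈ A.erase b, (2 * κ + if y = p a then 1 else 0) ≤
          3 * κ * A.card := by
        have h1 : ∑ y, w y * ∑ a ∈ A.erase b, (2 * κ + if y = p a then 1 else 0) =
            ∑ a ∈ A.erase b, (2 * κ + w (p a)) := by
          simp only [Finset.mul_sum]
          rw [Finset.sum_comm]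
          refine Finset.sum_congr rfl fun a _ => ?_
          simp only [mul_add, Finset.sum_add_distrib, ← Finset.sum_mul, hw1, one_mul]
          simp
        rw [h1]
        calc _ ≤ ∑ a ∈ A.erase b, 3 * κ :=
              Finset.sum_le_sum fun a _ => by linarith [hκ (p a)]
          _ ≤ ∑ a ∈ A, 3 * κ := Finset.sum_le_sum_of_subset_of_nonneg (Finset.erase_subset _ _)
              fun _ _ _ => by positivity
          _ = _ := by simp; ring
      have hu : 0 ≤ ∑ ξ, u ξ ^ 2 := Finset.sum_nonneg fun _ _ => sq_nonneg _
      have hsplit : ∑ ξ, (∏ a ∈ A, φ a (ξ (p a)) - ∏ a ∈ A, ψ (insert b B) a ξ) * u ξ ^ 2 =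
          ∑ ξ, (∏ a ∈ A, φ a (ξ (p a)) - ∏ a ∈ A, ψ B a ξ) * u ξ ^ 2 +
          ∑ ξ, G ξ * (φ b (ξ (p b)) - siteAverage w (φ b) ξ) * u ξ ^ 2 := by
        rw [← Finset.sum_add_distrib]
        refine Finset.sum_congr rfl fun ξ _ => ?_
        rw [← hstep]
        ring
      rw [hsplit, Finset.card_insert_of_notMem hb]
      push_cast
      refine (abs_add_le _ _).trans ?_
      have := mul_le_mul_of_nonneg_right hsum hu
      linarith
  have h := key A subset_rfl
  have h2 : ∀ ξ, ∏ a ∈ A, ψ A a ξ = ∏ a ∈ A, siteAverage w (φ a) ξ := fun ξ =>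
    Finset.prod_congr rfl fun a ha => by simp [ψ, ha]
  simpa only [h2] using h

end Replacement

/-! ### Cylinder expansion and Bernoulli means -/

section Cylinder

/-- The configuration on `ℤ` that agrees with `σ` on `A` and is empty elsewhere. -/
def extendByEmpty {A : Finset ℤ} (σ : A → Bool) : ZConfig :=
  fun z => if h : z ∈ A then σ ⟨z, h⟩ else false

/-- Exactly one pattern `σ` agrees with `η` on `A`. This reduces local functions to products of
one-site indicators. -/
theorem eq_sum_cylinder {f : ZConfig → ℝ} {A : Finset ℤ} (hf : DependsOn f (A : Set ℤ))
    (η : ZConfig) : f η = ∑ σ : A → Bool, f (extendByEmpty σ) *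
      ∏ z ∈ A, if η z = extendByEmpty σ z then 1 else 0 := by
  classical
  rw [Finset.sum_eq_single fun a : A => η a]
  · have h : ∀ z ∈ A, η z = extendByEmpty (fun a : A => η a) z := fun z hz => by
      simp [extendByEmpty, hz]
    rw [Finset.prod_congr rfl fun z hz => if_pos (h z hz), Finset.prod_const_one, mul_one]
    exact hf h
  · intro σ _ hσ
    obtain ⟨a, ha⟩ := Function.ne_iff.mp hσ
    rw [Finset.prod_eq_zero a.2, mul_zero]
    rw [if_neg]
    intro h
    refine ha ?_
    simp [extendByEmpty] at h
    exact h.symm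
  · simp

theorem bernoulliMeasure_real_singleton (ρ : unitInterval) (v : Bool) :
    (bernoulliMeasure true false ρ).real {v} = if v then (ρ : ℝ) else 1 - ρ := by
  rw [bernoulliMeasure_real_apply ρ (measurableSet_singleton v)]
  cases v <;> simp

theorem integral_cylinder (ρ : unitInterval) (A : Finset ℤ) (s : ZConfig) :
    Integrable (fun η : ZConfig => ∏ z ∈ A, if η z = s z then (1 : ℝ) else 0)
      (bernoulliProduct ρ) ∧
    ∫ η, ∏ z ∈ A, (if η z = s z then (1 : ℝ) else 0) ∂bernoulliProduct ρ =
      ∏ z ∈ A, if s z then (ρ : ℝ) else 1 - ρ := by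
  have h : (fun η : ZConfig => ∏ z ∈ A, if η z = s z then (1 : ℝ) else 0) =
      ((A : Set ℤ).pi fun z => {s z}).indicator 1 := by
    funext η
    classical
    rw [Finset.prod_ite_zero, Finset.prod_const_one, Set.indicator_apply]
    simp only [Set.mem_pi, Finset.mem_coe, mem_singleton_iff, Pi.one_apply]
  have hm : MeasurableSet ((A : Set ℤ).pi fun z => {s z}) :=
    MeasurableSet.pi A.countable_toSet fun z _ => measurableSet_singleton _
  have : IsProbabilityMeasure (bernoulliProduct ρ) := by
    unfold bernoulliProduct; infer_instance
  rw [h]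
  refine ⟨(integrable_const (1 : ℝ)).indicator hm, ?_⟩
  rw [integral_indicator_one hm, measureReal_def, bernoulliProduct,
    Measure.infinitePi_pi _ fun z _ => measurableSet_singleton _, ENNReal.toReal_prod]
  exact Finset.prod_congr rfl fun z _ => bernoulliMeasure_real_singleton ρ (s z)

theorem bernoulliMean_eq {f : ZConfig → ℝ} {A : Finset ℤ} (hf : DependsOn f (A : Set ℤ))
    (ρ : unitInterval) : bernoulliMean f ρ = ∑ σ : A → Bool, f (extendByEmpty σ) *
      ∏ z ∈ A, if extendByEmpty σ z then (ρ : ℝ) else 1 - ρ := by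
  rw [bernoulliMean, integral_congr_ae (ae_of_all _ fun η => eq_sum_cylinder hf η),
    integral_finsetSum _ fun σ _ => (integral_cylinder ρ A (extendByEmpty σ)).1.const_mul _]
  exact Finset.sum_congr rfl fun σ _ => by
    rw [integral_const_mul, (integral_cylinder ρ A (extendByEmpty σ)).2]

end Cylinder

/-! ### Weights of the empirical box -/

/-- The weight of the site `x` in the empirical box. -/
def boxWeight (n : ℕ+) (ε : ℝ) (x : Site n) : ℝ :=
  (1 / ε) * ∫ y in (0 : ℝ)..ε, finiteElement n x (y : UnitAddCircle)

theorem finiteElement_nonneg (n : ℕ+) (x : Site n) (y : UnitAddCircle) :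
    0 ≤ finiteElement n x y := le_max_right _ _

theorem continuous_finiteElement (n : ℕ+) (x : Site n) : Continuous (finiteElement n x) := by
  unfold finiteElement
  fun_prop

theorem intervalIntegrable_finiteElement (n : ℕ+) (x : Site n) (a b : ℝ) :
    IntervalIntegrable (fun y : ℝ => finiteElement n x (y : UnitAddCircle)) volume a b :=
  ((continuous_finiteElement n x).comp (AddCircle.continuous_mk' 1)).intervalIntegrable a b

theorem empiricalBox_eq_sum (n : ℕ+) (ξ : Config n) (ε : ℝ) :
    empiricalBox n ξ ε = ∑ x, boxWeight n ε x * if ξ x then 1 else 0 := by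
  have h : ∀ x : Site n, (∫ y in (0 : ℝ)..ε,
      if ξ x then finiteElement n x (y : UnitAddCircle) else 0) =
      (∫ y in (0 : ℝ)..ε, finiteElement n x (y : UnitAddCircle)) * if ξ x then 1 else 0 :=
    fun x => by split_ifs <;> simp
  simp only [empiricalBox, empiricalDensity, boxWeight]
  rw [intervalIntegral.integral_finsetSum, Finset.mul_sum]
  · exact Finset.sum_congr rfl fun x _ => by rw [h]; ring
  · intro x _
    split_ifs
    · exact intervalIntegrable_finiteElement n x 0 ε
    · exact intervalIntegrable_const

theorem one_sub_abs_le_finiteElement (n : ℕ+) (k : ℤ) (r : ℝ) :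
    1 - |n * r - k| ≤ finiteElement n (k : Site n) (r : UnitAddCircle) := by
  have hn : (0 : ℝ) < (n : ℝ) := by exact_mod_cast n.pos
  refine le_trans ?_ (le_max_left _ _)
  have h : ‖(r : UnitAddCircle) - ZMod.toAddCircle (k : Site n)‖ ≤ |r - k / n| := by
    rw [ZMod.toAddCircle_intCast, ← AddCircle.coe_sub, UnitAddCircle.norm_eq]
    simpa using round_le (r - k / n) 0
  have h2 : |n * r - k| = n * |r - k / n| := by
    nth_rewrite 2 [← abs_of_pos hn]
    rw [← abs_mul]
    congr 1
    field_simp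
  rw [h2]
  have := mul_le_mul_of_nonneg_left h hn.le
  linarith

/-- The upper bound is the density bound for the full configuration. For the lower bound, the two
lattice points around `n r` already contribute 1; they are distinct sites because `n ≥ 2`. -/
theorem sum_finiteElement {n : ℕ+} (hn : 2 ≤ (n : ℕ)) (y : UnitAddCircle) :
    ∑ x, finiteElement n x y = 1 := by
  refine le_antisymm (by simpa [empiricalDensity] using empiricalDensity_le_one n (fun _ => true) y) ?_
  induction y using QuotientAddGroup.induction_on with
  | H r =>
    have h1 := one_sub_abs_le_finiteElement n ⌊(n : ℝ) * r⌋ r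
    have h2 := one_sub_abs_le_finiteElement n (⌊(n : ℝ) * r⌋ + 1) r
    have h3 := Int.fract_nonneg ((n : ℝ) * r)
    have h4 := Int.fract_lt_one ((n : ℝ) * r)
    have h5 := Int.floor_add_fract ((n : ℝ) * r)
    have hne : ((⌊(n : ℝ) * r⌋ : ℤ) : Site n) ≠ ((⌊(n : ℝ) * r⌋ + 1 : ℤ) : Site n) := by
      push_cast
      simpa using site_one_ne_zero hn
    have h6 := Finset.sum_le_sum_of_subset_of_nonneg
      (Finset.subset_univ {((⌊(n : ℝ) * r⌋ : ℤ) : Site n), ((⌊(n : ℝ) * r⌋ + 1 : ℤ) : Site n)})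
      fun x _ _ => finiteElement_nonneg n x (r : UnitAddCircle)
    rw [Finset.sum_pair hne] at h6
    rw [abs_of_nonneg (by linarith)] at h1
    rw [abs_of_nonpos (by push_cast; linarith)] at h2
    push_cast at h2
    refine le_trans ?_ h6
    push_cast
    linarith

theorem boxWeight_nonneg (n : ℕ+) {ε : ℝ} (hε : 0 < ε) (x : Site n) : 0 ≤ boxWeight n ε x :=
  mul_nonneg (by positivity)
    (intervalIntegral.integral_nonneg hε.le fun _ _ => finiteElement_nonneg _ _ _)

theorem sum_boxWeight {n : ℕ+} (hn : 2 ≤ (n : ℕ)) {ε : ℝ} (hε : 0 < ε) :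
    ∑ x, boxWeight n ε x = 1 := by
  simp only [boxWeight]
  rw [← Finset.mul_sum, ← intervalIntegral.integral_finsetSum fun x _ =>
    intervalIntegrable_finiteElement n x 0 ε]
  simp only [sum_finiteElement hn]
  simp [hε.ne']

/-- By translation invariance all `n` sites have the same integral, and these integrals sum to 1. -/
theorem integral_finiteElement {n : ℕ+} (hn : 2 ≤ (n : ℕ)) (x : Site n) :
    ∫ y in (0 : ℝ)..1, finiteElement n x (y : UnitAddCircle) = 1 / n := by
  have hn0 : (0 : ℝ) < (n : ℝ) := by exact_mod_cast n.pos
  have h : ∀ x : Site n, ∫ y in (0 : ℝ)..1, finiteElement n x (y : UnitAddCircle) =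
      ∫ y, finiteElement n 0 y := fun x => by
    have h1 := UnitAddCircle.intervalIntegral_preimage 0 (finiteElement n x)
    rw [zero_add] at h1
    rw [h1, ← integral_sub_right_eq_self (finiteElement n 0) (ZMod.toAddCircle x)]
    simp [finiteElement]
  have h2 : ∑ x : Site n, ∫ y in (0 : ℝ)..1, finiteElement n x (y : UnitAddCircle) = 1 := by
    rw [← intervalIntegral.integral_finsetSum fun x _ => intervalIntegrable_finiteElement n x 0 1]
    simp only [sum_finiteElement hn]
    simp
  simp only [h, Finset.sum_const, Finset.card_univ, ZMod.card, nsmul_eq_mul] at h2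
  rw [h x, eq_div_iff hn0.ne', mul_comm]
  exact h2

theorem boxWeight_le {n : ℕ+} (hn : 2 ≤ (n : ℕ)) {ε : ℝ} (hε : 0 < ε) (hε1 : ε ≤ 1) (x : Site n) :
    boxWeight n ε x ≤ 1 / (ε * n) := by
  have h : ∫ y in (0 : ℝ)..ε, finiteElement n x (y : UnitAddCircle) ≤
      ∫ y in (0 : ℝ)..1, finiteElement n x (y : UnitAddCircle) :=
    intervalIntegral.integral_mono_interval le_rfl hε.le hε1
      (ae_of_all _ fun y => finiteElement_nonneg n x y) (intervalIntegrable_finiteElement n x 0 1)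
  rw [integral_finiteElement hn] at h
  calc boxWeight n ε x ≤ 1 / ε * (1 / n) := mul_le_mul_of_nonneg_left h (by positivity)
    _ = _ := by field_simp

/-- At `r ∈ [0, ε]` only the classes of `⌊n r⌋` and `⌊n r⌋ + 1` can carry a nonzero finite element.
-/
theorem exists_intCast_of_boxWeight_ne_zero {n : ℕ+} {ε : ℝ} (hε : 0 < ε) {x : Site n}
    (hx : boxWeight n ε x ≠ 0) : ∃ j : ℤ, 0 ≤ j ∧ (j : ℝ) ≤ ε * n + 1 ∧ x = j := by
  have hn0 : (0 : ℝ) < (n : ℝ) := by exact_mod_cast n.pos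
  by_contra hcon
  push Not at hcon
  refine hx ?_
  rw [boxWeight, intervalIntegral.integral_congr (g := fun _ => (0 : ℝ))]
  · simp
  intro r hr
  rw [uIcc_of_le hε.le] at hr
  refine le_antisymm ((finiteElement_le n r x).trans ?_) (finiteElement_nonneg _ _ _)
  have h0 : 0 ≤ ⌊(n : ℝ) * r⌋ := Int.floor_nonneg.mpr (mul_nonneg hn0.le hr.1)
  have h1 : (⌊(n : ℝ) * r⌋ : ℝ) ≤ ε * n :=
    (Int.floor_le _).trans (by rw [mul_comm]; exact mul_le_mul_of_nonneg_right hr.2 hn0.le)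
  rw [if_neg (hcon _ h0 (by linarith)), if_neg (hcon _ (by omega) (by push_cast; linarith)), add_zero]

/-! ### Replacement estimate for the local error -/

theorem sum_sq_exchange_intCast_le {n : ℕ+} (u : Config n → ℝ) (i j : ℤ) (h : |i - j| < n) :
    ∑ η, (u (exchange (i : Site n) (j : Site n) η) - u η) ^ 2 ≤
      4 * ((|i - j| : ℤ) : ℝ) * bondEnergy u := by
  wlog hij : i ≤ j generalizing i j
  · rw [exchange_comm, abs_sub_comm]
    exact this j i (by rwa [abs_sub_comm]) (by omega)
  obtain ⟨d, rfl⟩ := Int.le.dest hij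
  have hd : |i - (i + d)| = d := by simp
  rw [hd] at h ⊢
  have := sum_sq_exchange_sub_le u (i : Site n) d (by exact_mod_cast h)
  push_cast
  exact this

/-- Averaging a one-site indicator yields its Bernoulli probability at the box density. So the
product of averages is exactly the Bernoulli weight of a cylinder, and the local error has no
further term to control. -/
theorem siteAverage_boxWeight {n : ℕ+} (hn : 2 ≤ (n : ℕ)) {ε : ℝ} (hε : 0 < ε) (s : Bool)
    (ξ : Config n) : siteAverage (boxWeight n ε) (fun v => if v = s then 1 else 0) ξ =
      if s then empiricalBox n ξ ε else 1 - empiricalBox n ξ ε := by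
  rw [siteAverage, empiricalBox_eq_sum]
  cases s
  · simp only [Bool.false_eq_true, if_false]
    rw [eq_sub_iff_add_eq, ← Finset.sum_add_distrib]
    refine Eq.trans (Finset.sum_congr rfl fun y _ => ?_) (sum_boxWeight hn hε)
    cases ξ y <;> simp
  · simp

theorem localError_eq_sum {n : ℕ+} (hn : 2 ≤ (n : ℕ)) {f : ZConfig → ℝ} {A : Finset ℤ}
    (hf : DependsOn f (A : Set ℤ)) {ε : ℝ} (hε : 0 < ε) (ξ : Config n) :
    localError n f ε ξ = ∑ σ : A → Bool, f (extendByEmpty σ) *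
      (∏ z ∈ A, (if ξ (z : Site n) = extendByEmpty σ z then 1 else 0) -
        ∏ z ∈ A, siteAverage (boxWeight n ε)
          (fun v => if v = extendByEmpty σ z then 1 else 0) ξ) := by
  rw [localError, bernoulliMean_eq hf, lift, eq_sum_cylinder hf, ← Finset.sum_sub_distrib]
  simp only [siteAverage_boxWeight hn hε, mul_sub]

theorem abs_sum_localError_le {f : ZConfig → ℝ} {A : Finset ℤ} (hA : DependsOn f (A : Set ℤ))
    {R : ℕ} (hR : ∀ a ∈ A, a.natAbs ≤ R) {ε : ℝ} (hε : 0 < ε) (hε2 : ε ≤ 1 / 2) {n : ℕ+}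
    (hn : 2 * R + 3 ≤ (n : ℕ)) (u : Config n → ℝ) {θ : ℝ} (hθ0 : 0 < θ) :
    |∑ ξ, localError n f ε ξ * u ξ ^ 2| ≤ (∑ σ : A → Bool, |f (extendByEmpty σ)|) *
      (A.card * (3 * (1 / (ε * n)) * A.card * ∑ ξ, u ξ ^ 2 +
        (1 / (2 * θ) * (4 * (ε * n + (R + 1)) * bondEnergy u) + 2 * θ * ∑ ξ, u ξ ^ 2))) := by
  have hn2 : 2 ≤ (n : ℕ) := by omega
  have hn0 : (0 : ℝ) < n := by exact_mod_cast n.pos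
  have hnR : (2 * R + 3 : ℝ) ≤ n := by exact_mod_cast hn
  set D := bondEnergy u
  set N := ∑ ξ, u ξ ^ 2
  have hD0 : 0 ≤ D := Finset.sum_nonneg fun _ _ => Finset.sum_nonneg fun _ _ => sq_nonneg _
  -- Bound on the distance between a site of `A`, within `R` of the origin, and a box site, whose
  -- representative lies in `[0, ε n + 1]`.
  set d : ℝ := ε * n + (R + 1) with hd
  have hinj : InjOn (fun z : ℤ => (z : Site n)) A := by
    intro a ha b hb hab
    have ha' := hR a ha
    have hb' := hR b hb
    obtain ⟨m, hm⟩ := (ZMod.intCast_eq_intCast_iff_dvd_sub a b n).mp hab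
    have hm0 : m = 0 := by
      by_contra hm0
      have h1 : (n : ℕ) * 1 ≤ n * m.natAbs :=
        Nat.mul_le_mul_left _ (Int.natAbs_pos.mpr hm0)
      have h2 : (b - a).natAbs = n * m.natAbs := by rw [hm, Int.natAbs_mul, Int.natAbs_natCast]
      omega
    rw [hm0] at hm
    omega
  have hΓ : ∀ b ∈ A, ∀ y, boxWeight n ε y ≠ 0 →
      ∑ ξ, |u (exchange (b : Site n) y ξ) ^ 2 - u ξ ^ 2| ≤
        1 / (2 * θ) * (4 * d * D) + 2 * θ * N := by
    intro b hb y hy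
    obtain ⟨j, hj0, hj, rfl⟩ := exists_intCast_of_boxWeight_ne_zero hε hy
    have hbR : (|b| : ℝ) ≤ R := by
      have := hR b hb
      have h2 : |b| ≤ (R : ℤ) := by rw [Int.abs_eq_natAbs]; exact_mod_cast this
      exact_mod_cast h2
    have hbj : ((|b - j| : ℤ) : ℝ) ≤ d := by
      push_cast
      refine (abs_sub _ _).trans ?_
      have : (0 : ℝ) ≤ j := by exact_mod_cast hj0
      rw [abs_of_nonneg this]
      linarith
    -- With `ε ≤ 1/2` this asks for `n > 2R + 2`, whence the threshold `2R + 3`; the path then does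
    -- not wrap around the circle.
    have hdn : d < n := by
      have : ε * n ≤ 1 / 2 * n := by gcongr
      linarith
    have hlt : |b - j| < (n : ℤ) := by
      have := hbj.trans_lt hdn
      exact_mod_cast this
    refine (sum_abs_sq_exchange_sub_le u _ _ hθ0).trans (add_le_add_left ?_ _)
    refine mul_le_mul_of_nonneg_left ((sum_sq_exchange_intCast_le u b j hlt).trans ?_)
      (by positivity)
    gcongr
  have hcyl : ∀ σ : A → Bool, |∑ ξ : Config n,
      (∏ z ∈ A, (if ξ (z : Site n) = extendByEmpty σ z then 1 else 0) -
        ∏ z ∈ A, siteAverage (boxWeight n ε)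
          (fun v => if v = extendByEmpty σ z then 1 else 0) ξ) * u ξ ^ 2| ≤
      A.card * (3 * (1 / (ε * n)) * A.card * N +
        (1 / (2 * θ) * (4 * d * D) + 2 * θ * N)) := fun σ =>
    abs_sum_prod_sub_prod_siteAverage_le A (fun z : ℤ => (z : Site n)) hinj
      (fun z v => if v = extendByEmpty σ z then 1 else 0)
      (fun z v => by split_ifs <;> simp) (boxWeight_nonneg n hε) (sum_boxWeight hn2 hε)
      (boxWeight_le hn2 hε (by linarith)) u hΓ
  have h1 : ∑ ξ, localError n f ε ξ * u ξ ^ 2 = ∑ σ : A → Bool, f (extendByEmpty σ) *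
      ∑ ξ : Config n, (∏ z ∈ A, (if ξ (z : Site n) = extendByEmpty σ z then 1 else 0) -
      ∏ z ∈ A, siteAverage (boxWeight n ε)
        (fun v => if v = extendByEmpty σ z then 1 else 0) ξ) * u ξ ^ 2 := by
    simp only [localError_eq_sum hn2 hA hε, Finset.sum_mul, Finset.mul_sum]
    rw [Finset.sum_comm]
    simp only [mul_assoc]
  rw [h1, Finset.sum_mul]
  refine (Finset.abs_sum_le_sum_abs _ _).trans (Finset.sum_le_sum fun σ _ => ?_)
  rw [abs_mul]
  exact mul_le_mul_of_nonneg_left (hcyl σ) (abs_nonneg _)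

/-- The choice `θ = 8αCd/n` makes the energy term exactly `(n/4) D`, which after multiplication by
`n` matches the dissipation of the exclusion part. The mass term is then of order `α² C² d/n`. -/
theorem replacement_arith {α C d n ε r D N F k X θ : ℝ} (hα : 0 < α) (hC : 0 < C) (hn : 0 < n)
    (hε : 0 < ε) (hr : 0 < r) (hD : 0 ≤ D) (hN : 0 ≤ N) (hk : 0 ≤ k) (hkC : k ≤ C)
    (hFC : F * k ≤ C) (hd : d = ε * n + r) (hθ : θ = 8 * α * C * d / n)
    (hX : X ≤ F * (k * (3 * (1 / (ε * n)) * k * N + (1 / (2 * θ) * (4 * d * D) + 2 * θ * N)))) :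
    α * X ≤ n / 4 * D + α * C * (3 * C / (ε * n) + 16 * α * C * (ε + r / n)) * N := by
  have hd0 : 0 < d := by rw [hd]; positivity
  have hθ0 : 0 < θ := by rw [hθ]; positivity
  have h1 : 1 / (2 * θ) * (4 * d * D) = n * D / (4 * α * C) := by
    rw [hθ]
    field_simp
    ring
  have h2 : θ = 8 * α * C * (ε + r / n) := by
    rw [hθ, hd]
    field_simp
  have h3 : 3 * (1 / (ε * n)) * k * N ≤ 3 * C / (ε * n) * N := by
    have : 3 * (1 / (ε * n)) * k * N = 3 * k / (ε * n) * N := by ring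
    rw [this]
    gcongr
  have h4 : 0 ≤ 3 * (1 / (ε * n)) * k * N + (1 / (2 * θ) * (4 * d * D) + 2 * θ * N) := by
    positivity
  have h5 : α * (C * (n * D / (4 * α * C))) = n / 4 * D := by field_simp
  calc α * X ≤ α * (F * (k * (3 * (1 / (ε * n)) * k * N +
        (1 / (2 * θ) * (4 * d * D) + 2 * θ * N)))) := mul_le_mul_of_nonneg_left hX hα.le
    _ = α * ((F * k) * (3 * (1 / (ε * n)) * k * N +
        (1 / (2 * θ) * (4 * d * D) + 2 * θ * N))) := by ring
    _ ≤ α * (C * (3 * (1 / (ε * n)) * k * N + (1 / (2 * θ) * (4 * d * D) + 2 * θ * N))) :=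
        mul_le_mul_of_nonneg_left (mul_le_mul_of_nonneg_right hFC h4) hα.le
    _ ≤ α * (C * (3 * C / (ε * n) * N + (1 / (2 * θ) * (4 * d * D) + 2 * θ * N))) := by gcongr
    _ = α * (C * (n * D / (4 * α * C))) + α * C * (3 * C / (ε * n) + 2 * θ) * N := by
        rw [h1]; ring
    _ = _ := by rw [h5, h2]; ring

/-- The local replacement lemma in quadratic form. -/
theorem exists_abs_sum_localError_le {f : ZConfig → ℝ} (hf : IsLocal f) :
    ∃ C : ℝ, 0 < C ∧ ∃ R : ℕ, ∀ α : ℝ, 0 < α → ∀ ε : ℝ, 0 < ε → ε ≤ 1 / 2 → ∀ n : ℕ+,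
      2 * R + 3 ≤ (n : ℕ) → ∀ u : Config n → ℝ,
      α * |∑ ξ, localError n f ε ξ * u ξ ^ 2| ≤ n / 4 * bondEnergy u +
        α * C * (3 * C / (ε * n) + 16 * α * C * (ε + (R + 1) / n)) * ∑ ξ, u ξ ^ 2 := by
  obtain ⟨A, hA⟩ := hf
  have hF0 : 0 ≤ ∑ σ : A → Bool, |f (extendByEmpty σ)| := Finset.sum_nonneg fun _ _ => abs_nonneg _
  have hk0 : (0 : ℝ) ≤ A.card := Nat.cast_nonneg _
  have hC0 : 0 < ((∑ σ : A → Bool, |f (extendByEmpty σ)|) + 1) * (A.card + 1) := by positivity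
  -- A positive constant dominating both `A.card` and the sum of coefficients times `A.card`; the
  -- sum of the `natAbs` serves as a crude radius for `A`.
  refine ⟨((∑ σ : A → Bool, |f (extendByEmpty σ)|) + 1) * (A.card + 1), hC0,
    ∑ a ∈ A, a.natAbs, ?_⟩
  intro α hα ε hε hε2 n hn u
  have hn0 : (0 : ℝ) < n := by exact_mod_cast n.pos
  have hR : ∀ a ∈ A, a.natAbs ≤ ∑ a ∈ A, a.natAbs := fun a ha =>
    Finset.single_le_sum (f := Int.natAbs) (fun _ _ => Nat.zero_le _) ha
  refine replacement_arith hα hC0 hn0 hε (by positivity)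
    (Finset.sum_nonneg fun _ _ => Finset.sum_nonneg fun _ _ => sq_nonneg _)
    (Finset.sum_nonneg fun _ _ => sq_nonneg _) hk0 (by nlinarith) (by nlinarith) rfl rfl
    (abs_sum_localError_le hA hR hε hε2 hn u (by positivity))

/-! ### Passing to the frame of the walker -/

section Shift

variable {n : ℕ+}

/-- The shift by `x` as a bijection. -/
def shiftEquiv (x : Site n) : Config n ≃ Config n where
  toFun := shift x
  invFun := shift (-x)
  left_inv η := by funext z; simp [shift]
  right_inv η := by funext z; simp [shift]

theorem exchange_shift (x y z : Site n) (η : Config n) :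
    exchange y z (shift x η) = shift x (exchange (y + x) (z + x) η) := by
  funext w
  simp only [exchange, shift, Equiv.swap_apply_def, add_left_inj]
  split_ifs <;> rfl

theorem bondEnergy_shift (x : Site n) (u : Config n → ℝ) :
    bondEnergy (fun ξ => u (shift x ξ)) = bondEnergy u := by
  have h : ∀ y, ∑ ξ, (u (exchange y (y + 1) ξ) - u ξ) ^ 2 =
      ∑ ξ, (u (shift x (exchange (y + x) (y + x + 1) ξ)) - u (shift x ξ)) ^ 2 := fun y => by
    rw [← (shiftEquiv x).sum_comp]
    refine Finset.sum_congr rfl fun ξ _ => ?_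
    change (u (exchange y (y + 1) (shift x ξ)) - u (shift x ξ)) ^ 2 = _
    rw [exchange_shift, add_right_comm]
  unfold bondEnergy
  simp only [h]
  exact (Equiv.sum_comp (Equiv.addRight x) fun y =>
    ∑ ξ, (u (shift x (exchange y (y + 1) ξ)) - u (shift x ξ)) ^ 2).symm

end Shift

/-- The bound for the perturbed generator. -/
theorem exists_form_le {f : ZConfig → ℝ} (hf : IsLocal f) {c : ℤˣ → ZConfig → ℝ}
    (hc : ∀ z η, 0 ≤ c z η) {K : ℝ} (hK : ∀ z η, c z η ≤ K) :
    ∃ C : ℝ, 0 < C ∧ ∃ R : ℕ, ∀ α : ℝ, 0 < α → ∀ ε : ℝ, 0 < ε → ε ≤ 1 / 2 → ∀ n : ℕ+,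
      2 * R + 3 ≤ (n : ℕ) → ∀ s : ℝ, |s| ≤ 1 → ∀ v : State n → ℝ,
      v ⬝ᵥ (rateMatrix n c).mulVec v +
        ∑ a, s * (n * α) * localError n f ε (seenFromWalker a) * v a ^ 2 ≤
      n * (K + α * C * (3 * C / (ε * n) + 16 * α * C * (ε + (R + 1) / n))) * ∑ a, v a ^ 2 := by
  obtain ⟨C, hC, R, h⟩ := exists_abs_sum_localError_le hf
  refine ⟨C, hC, R, fun α hα ε hε hε2 n hn s hs v => ?_⟩
  have h' := h α hα ε hε hε2 n hn
  set β := α * C * (3 * C / (ε * n) + 16 * α * C * (ε + (R + 1) / n))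
  -- With the walker frozen at `x`, the change of variables `ξ = τ_x η` reduces to the static
  -- estimate, since the Dirichlet form is shift invariant.
  have hx : ∀ x : Site n, s * (α * ∑ η, localError n f ε (shift x η) * v (η, x) ^ 2) ≤
      n / 4 * bondEnergy (fun η => v (η, x)) + β * ∑ η, v (η, x) ^ 2 := fun x => by
    have h1 := h' fun ξ => v (shift (-x) ξ, x)
    rw [bondEnergy_shift (-x) fun η => v (η, x)] at h1
    have h2 : ∑ ξ, localError n f ε ξ * v (shift (-x) ξ, x) ^ 2 =
        ∑ η, localError n f ε (shift x η) * v (η, x) ^ 2 := by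
      rw [← (shiftEquiv x).sum_comp]
      refine Finset.sum_congr rfl fun η _ => ?_
      change localError n f ε (shift x η) * v ((shiftEquiv x).symm (shiftEquiv x η), x) ^ 2 = _
      rw [Equiv.symm_apply_apply]
    have h3 : ∑ ξ, v (shift (-x) ξ, x) ^ 2 = ∑ η, v (η, x) ^ 2 :=
      (shiftEquiv (-x)).sum_comp fun η => v (η, x) ^ 2
    rw [h2, h3] at h1
    refine le_trans ?_ h1
    refine (le_abs_self _).trans ?_
    rw [abs_mul, abs_mul, abs_of_pos hα]
    exact mul_le_of_le_one_left (by positivity) hs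
  have hsum := Finset.sum_le_sum fun x (_ : x ∈ Finset.univ) => hx x
  rw [Finset.sum_add_distrib, ← Finset.mul_sum, ← Finset.mul_sum, ← Finset.mul_sum,
    ← Finset.mul_sum, ← Fintype.sum_prod_type_right' (f := fun η x => v (η, x) ^ 2),
    ← Fintype.sum_prod_type_right'
      (f := fun η x => localError n f ε (shift x η) * v (η, x) ^ 2)] at hsum
  have h4 := dotProduct_rateMatrix_le (by omega : 2 ≤ (n : ℕ)) hc hK v
  have h5 : ∑ a, s * (n * α) * localError n f ε (seenFromWalker a) * v a ^ 2 =
      n * (s * (α * ∑ a : State n, localError n f ε (shift a.2 a.1) * v (a.1, a.2) ^ 2)) := by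
    simp only [Finset.mul_sum]
    exact Finset.sum_congr rfl fun a _ => by rw [seenFromWalker]; ring
  have h6 := mul_le_mul_of_nonneg_left hsum (Nat.cast_nonneg (α := ℝ) (n : ℕ))
  rw [h5]
  change _ ≤ (n : ℝ) * (_ + β * ∑ a, v a ^ 2) at h6
  linarith

/-! ### Riemann sums along càdlàg paths -/

section Riemann

variable {S : Type*}

/-- The ceiling selects right endpoints of the grid cells, as in the path sums weighted by `a
i.succ`. -/
theorem integral_ceil_eq_sum (G : ℤ → ℝ) {h : ℝ} (hh : 0 < h) (N : ℕ) :
    ∫ s in (0 : ℝ)..(N * h), G ⌈s / h⌉ = ∑ i : Fin N, h * G (i + 1) := by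
  have hmeas : Measurable fun s : ℝ => G ⌈s / h⌉ :=
    (measurable_of_countable G).comp (Int.measurable_ceil.comp (measurable_id.div_const h))
  have hpiece : ∀ k : ℕ, EqOn (fun s : ℝ => G ⌈s / h⌉) (fun _ => G (k + 1))
      (Ioc ((k : ℝ) * h) (((k + 1 : ℕ) : ℝ) * h)) := fun k s hs => by
    have : ⌈s / h⌉ = (k : ℤ) + 1 := by
      rw [Int.ceil_eq_iff]
      push_cast at hs ⊢
      exact ⟨by rw [add_sub_cancel_right, lt_div_iff₀ hh]; exact hs.1,
        by rw [div_le_iff₀ hh]; exact hs.2⟩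
    simp only [this]
  have hle : ∀ k : ℕ, (k : ℝ) * h ≤ ((k + 1 : ℕ) : ℝ) * h := fun k => by push_cast; linarith
  have hint : ∀ k : ℕ, IntervalIntegrable (fun s : ℝ => G ⌈s / h⌉) volume (k * h)
      (((k + 1 : ℕ) : ℝ) * h) := fun k => by
    rw [intervalIntegrable_iff_integrableOn_Ioc_of_le (hle k)]
    exact (integrableOn_const (C := G (k + 1)) (by simp)).congr_fun (hpiece k).symm measurableSet_Ioc
  have hsum := intervalIntegral.sum_integral_adjacent_intervals (μ := volume)
    (a := fun k : ℕ => (k : ℝ) * h) (n := N) fun k _ => hint k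
  simp only [Nat.cast_zero, zero_mul] at hsum
  rw [← hsum, ← Fin.sum_univ_eq_sum_range
    (fun k => ∫ s in ((k : ℝ) * h)..(((k + 1 : ℕ) : ℝ) * h), G ⌈s / h⌉)]
  refine Finset.sum_congr rfl fun k _ => ?_
  rw [intervalIntegral.integral_of_le (hle k), setIntegral_congr_fun measurableSet_Ioc (hpiece k),
    ← intervalIntegral.integral_of_le (hle k), intervalIntegral.integral_const, smul_eq_mul]
  push_cast
  ring

/-- Convergence of the Riemann sums of a right-continuous path. -/
theorem tendsto_sum_path [Finite S] (U : S → ℝ) (x : ℝ → S) {t : ℝ} (ht : 0 ≤ t)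
    (hx : ∀ s ∈ Ico 0 t, ∀ᶠ r in 𝓝[>] s, x r = x s) :
    Tendsto (fun N : ℕ => ∑ i : Fin N, t / N * U (x (((i : ℕ) + 1 : ℝ) * (t / N)))) atTop
      (𝓝 (∫ s in (0 : ℝ)..t, U (x s))) := by
  rcases ht.eq_or_lt with rfl | ht0
  · simp
  obtain ⟨B, hB⟩ := (Set.finite_range fun a => |U a|).bddAbove
  have hB' : ∀ a, |U a| ≤ B := fun a => hB ⟨a, rfl⟩
  -- The sampled time is the first grid point at or after `s`. It approaches `s` from the right,
  -- where the path eventually equals `x s`.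
  let F : ℕ → ℝ → ℝ := fun N s => U (x ((⌈s / (t / N)⌉ : ℤ) * (t / N)))
  have hF : Tendsto (fun N => ∫ s in (0 : ℝ)..t, F N s) atTop (𝓝 (∫ s in (0 : ℝ)..t, U (x s))) := by
    refine intervalIntegral.tendsto_integral_filter_of_dominated_convergence (fun _ => B) ?_ ?_
      intervalIntegrable_const ?_
    · refine Eventually.of_forall fun N => Measurable.aestronglyMeasurable ?_
      exact (measurable_of_countable fun j : ℤ => U (x (j * (t / N)))).comp
        (Int.measurable_ceil.comp (measurable_id.div_const _))
    · exact Eventually.of_forall fun N => ae_of_all _ fun s _ => hB' _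
    · have hne : ∀ᵐ s : ℝ, s ≠ t := by simp [ae_iff]
      filter_upwards [hne] with s hst hs
      rw [uIoc_of_le ht] at hs
      have hs' : s ∈ Ico 0 t := ⟨hs.1.le, lt_of_le_of_ne hs.2 hst⟩
      have h1 : ∀ᶠ r in 𝓝[≥] s, x r = x s := by
        rw [← Set.Ioi_insert, nhdsWithin_insert, eventually_sup, eventually_pure]
        exact ⟨rfl, hx s hs'⟩
      have hh : ∀ᶠ N : ℕ in atTop, 0 < t / (N : ℝ) := by
        filter_upwards [eventually_gt_atTop 0] with N hN
        have : (0 : ℝ) < N := by exact_mod_cast hN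
        positivity
      have hge : ∀ᶠ N : ℕ in atTop, s ≤ (⌈s / (t / N)⌉ : ℤ) * (t / N) := by
        filter_upwards [hh] with N hN
        rw [← div_le_iff₀ hN]
        exact Int.le_ceil _
      have hlt : ∀ᶠ N : ℕ in atTop, (⌈s / (t / N)⌉ : ℤ) * (t / N) ≤ s + t / N := by
        filter_upwards [hh] with N hN
        have h2 := mul_le_mul_of_nonneg_right (Int.ceil_lt_add_one (s / (t / N))).le hN.le
        rwa [add_mul, one_mul, div_mul_cancel₀ _ hN.ne'] at h2
      have hlim : Tendsto (fun N : ℕ => (⌈s / (t / N)⌉ : ℤ) * (t / N)) atTop (𝓝[≥] s) := by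
        refine tendsto_nhdsWithin_iff.mpr ⟨?_, hge⟩
        refine tendsto_of_tendsto_of_tendsto_of_le_of_le' tendsto_const_nhds ?_ hge hlt
        simpa using tendsto_const_nhds.add (tendsto_const_div_atTop_nhds_zero_nat t)
      refine tendsto_const_nhds.congr' ?_
      filter_upwards [hlim.eventually h1] with N hN
      simp only [F, hN]
  refine hF.congr' ?_
  filter_upwards [eventually_gt_atTop 0] with N hN
  have hN0 : (0 : ℝ) < N := by exact_mod_cast hN
  have h := integral_ceil_eq_sum (fun j : ℤ => U (x (j * (t / N)))) (h := t / N) (by positivity) N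
  rw [mul_div_cancel₀ _ hN0.ne'] at h
  simp only [F, h]
  push_cast
  rfl

end Riemann

/-! ### Exponential moments of the additive functional -/

section Law

theorem sum_pmf_toReal {α : Type*} [Fintype α] (μ : PMF α) : ∑ a, (μ a).toReal = 1 := by
  rw [← ENNReal.toReal_sum fun a _ => μ.apply_ne_top a, ← tsum_fintype (L := .unconditional α) (fun a => μ a), μ.tsum_coe]
  rfl

variable {E : Type*} [MeasurableSpace E] {P : Measure E} [IsProbabilityMeasure P] {n : ℕ+}
  {c : ℤˣ → ZConfig → ℝ} {T : ℝ} {μ : PMF (Config n)} {X : ℝ → E → State n}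

/-- The initial law of the pair. -/
def initialLaw (μ : PMF (Config n)) (a : State n) : ℝ :=
  (μ a.1).toReal * if a.2 = 0 then 1 else 0

theorem initialLaw_nonneg (μ : PMF (Config n)) (a : State n) : 0 ≤ initialLaw μ a :=
  mul_nonneg ENNReal.toReal_nonneg (by split_ifs <;> simp)

theorem sum_initialLaw (μ : PMF (Config n)) : ∑ a, initialLaw μ a = 1 := by
  rw [Fintype.sum_prod_type, ← sum_pmf_toReal μ]
  refine Finset.sum_congr rfl fun η _ => ?_
  simp [initialLaw]

/-- The integrand takes finitely many values, one for each sampled trajectory, so measurability and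
expectation both come from the finite-dimensional distributions. -/
theorem measurable_exp_sum_path (hX : IsEnvironmentAndWalk P n c T μ X) (U : State n → ℝ) {t : ℝ}
    (ht : t ∈ Icc 0 T) (N : ℕ) :
    Measurable (fun ω => ENNReal.ofReal (Real.exp
      (∑ i : Fin N, t / N * U (X (((i : ℕ) + 1 : ℝ) * (t / N)) ω)))) ∧
    ∫⁻ ω, ENNReal.ofReal (Real.exp
      (∑ i : Fin N, t / N * U (X (((i : ℕ) + 1 : ℝ) * (t / N)) ω))) ∂P =
    ENNReal.ofReal (∑ a : Fin (N + 1) → State n, initialLaw μ (a 0) *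
      (∏ i : Fin N, NormedSpace.exp ((t / N) • rateMatrix n c) (a i.castSucc) (a i.succ)) *
        Real.exp (∑ i : Fin N, t / N * U (a i.succ))) := by
  classical
  let τ : Fin (N + 1) → ℝ := fun i => (i : ℕ) * (t / N)
  have hh : 0 ≤ t / N := div_nonneg ht.1 (Nat.cast_nonneg N)
  have hτmono : Monotone τ := fun i j hij =>
    mul_le_mul_of_nonneg_right (by exact_mod_cast hij) hh
  have hτ0 : τ 0 = 0 := by simp [τ]
  have hτT : ∀ i, τ i ≤ T := fun i => by
    refine le_trans ?_ ht.2
    -- For `N = 0`, division by zero makes the step 0, and the only sampled time is 0.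
    rcases Nat.eq_zero_or_pos N with rfl | hN
    · simp [τ, ht.1]
    · have hN0 : (0 : ℝ) < N := by exact_mod_cast hN
      have hi : ((i : ℕ) : ℝ) ≤ N := by exact_mod_cast Nat.lt_succ_iff.mp i.2
      calc τ i ≤ N * (t / N) := mul_le_mul_of_nonneg_right hi hh
        _ = t := mul_div_cancel₀ t hN0.ne'
  let A : (Fin (N + 1) → State n) → Set E := fun a => {ω | ∀ i, X (τ i) ω = a i}
  have hA : ∀ a, MeasurableSet (A a) := fun a => by
    have : A a = ⋂ i, {ω | X (τ i) ω = a i} := by ext ω; simp [A]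
    rw [this]
    exact MeasurableSet.iInter fun i =>
      hX.measurable _ ⟨hτ0 ▸ hτmono (Fin.zero_le i), hτT i⟩ _
  let g : (Fin (N + 1) → State n) → ℝ := fun a => Real.exp (∑ i : Fin N, t / N * U (a i.succ))
  have hG : (fun ω => ENNReal.ofReal (Real.exp
      (∑ i : Fin N, t / N * U (X (((i : ℕ) + 1 : ℝ) * (t / N)) ω)))) =
      fun ω => ∑ a, (A a).indicator (fun _ => ENNReal.ofReal (g a)) ω := by
    funext ω
    rw [Finset.sum_eq_single fun i => X (τ i) ω]
    · rw [indicator_of_mem (by simp [A])]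
      simp [g, τ]
    · intro a _ ha
      refine indicator_of_notMem (fun hω => ha ?_) _
      exact (funext hω).symm
    · simp
  rw [hG]
  have hm : ∀ a ∈ (Finset.univ : Finset (Fin (N + 1) → State n)),
      Measurable ((A a).indicator fun _ => ENNReal.ofReal (g a)) :=
    fun a _ => measurable_const.indicator (hA a)
  refine ⟨Finset.measurable_sum _ hm, ?_⟩
  have hlaw : ∀ a, P.real (A a) = initialLaw μ (a 0) *
      ∏ i : Fin N, NormedSpace.exp ((t / N) • rateMatrix n c) (a i.castSucc) (a i.succ) :=
    fun a => by
      rw [hX.law N τ hτmono hτ0 hτT a]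
      have : ∀ i : Fin N, τ i.succ - τ i.castSucc = t / N := fun i => by
        simp only [τ, Fin.val_succ, Fin.val_castSucc]
        push_cast
        ring
      simp only [this, transition, initialLaw]
  rw [lintegral_finsetSum _ hm, ENNReal.ofReal_sum_of_nonneg]
  · refine Finset.sum_congr rfl fun a _ => ?_
    rw [lintegral_indicator_const (hA a), ← hlaw, ENNReal.ofReal_mul measureReal_nonneg,
      ofReal_measureReal, mul_comm]
  · intro a _
    rw [← hlaw]
    exact mul_nonneg measureReal_nonneg (Real.exp_nonneg _)

/-- Fatou's lemma passes the discrete Feynman-Kac bound from Riemann sums to the time integral,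
whose exponential is measurable as their pointwise limit. Markov's inequality concludes. -/
theorem measure_le_integral_le (hX : IsEnvironmentAndWalk P n c T μ X) (U : State n → ℝ) {t : ℝ}
    (ht : t ∈ Icc 0 T) {l l' : ℝ} (hl : l < l')
    (hQ : ∀ v : State n → ℝ, v ⬝ᵥ (rateMatrix n c).mulVec v + ∑ a, U a * v a ^ 2 ≤
      l * ∑ a, v a ^ 2) (b : ℝ) :
    P {ω | b ≤ ∫ s in (0 : ℝ)..t, U (X s ω)} ≤
      ENNReal.ofReal (√(Fintype.card (State n)) * Real.exp (l' * t - b)) := by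
  let G : ℕ → E → ENNReal := fun N ω => ENNReal.ofReal (Real.exp
      (∑ i : Fin N, t / N * U (X (((i : ℕ) + 1 : ℝ) * (t / N)) ω)))
  let H : E → ENNReal := fun ω => ENNReal.ofReal (Real.exp (∫ s in (0 : ℝ)..t, U (X s ω)))
  have hGm : ∀ N, Measurable (G N) := fun N => (measurable_exp_sum_path hX U ht N).1
  have hlim : ∀ ω, Tendsto (fun N => G N ω) atTop (𝓝 (H ω)) := fun ω =>
    ENNReal.tendsto_ofReal ((Real.continuous_exp.tendsto _).comp
      (tendsto_sum_path U (fun s => X s ω) ht.1 fun s hs =>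
        hX.right_continuous ω s ⟨hs.1, hs.2.trans_le ht.2⟩))
  have hHm : Measurable H :=
    measurable_of_tendsto_metrizable hGm (tendsto_pi_nhds.mpr hlim)
  have hH : ∫⁻ ω, H ω ∂P ≤
      ENNReal.ofReal (√(Fintype.card (State n)) * Real.exp (l' * t)) := by
    calc ∫⁻ ω, H ω ∂P = ∫⁻ ω, liminf (fun N => G N ω) atTop ∂P :=
          lintegral_congr fun ω => (hlim ω).liminf_eq.symm
      _ ≤ liminf (fun N => ∫⁻ ω, G N ω ∂P) atTop := lintegral_liminf_le hGm
      _ ≤ _ := by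
        refine liminf_le_of_frequently_le' (Eventually.frequently ?_)
        filter_upwards [eventually_sum_path_exp_le (rateMatrix n c) U hl hQ (initialLaw μ)
          (initialLaw_nonneg μ) (sum_initialLaw μ) ht.1] with N hN
        rw [(measurable_exp_sum_path hX U ht N).2]
        exact ENNReal.ofReal_le_ofReal hN
  have hset : {ω | b ≤ ∫ s in (0 : ℝ)..t, U (X s ω)} =
      {ω | ENNReal.ofReal (Real.exp b) ≤ H ω} := by
    ext ω
    simp only [mem_ofPred_eq, H]
    rw [ENNReal.ofReal_le_ofReal_iff (Real.exp_nonneg _), Real.exp_le_exp]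
  rw [hset]
  refine (meas_ge_le_lintegral_div hHm.aemeasurable (by simpa using Real.exp_pos b)
    ENNReal.ofReal_ne_top).trans ?_
  rw [Real.exp_sub, ← mul_div_assoc, ENNReal.ofReal_div_of_pos (Real.exp_pos b)]
  exact ENNReal.div_le_div_right hH _

end Law

/-! ### Deviation bound at fixed scales -/

theorem sqrt_card_state_le (n : ℕ+) : √(Fintype.card (State n)) ≤ Real.exp n := by
  have h1 : Fintype.card (State n) = 2 ^ (n : ℕ) * n := by
    simp [State, Config, Site, ZMod.card]
  rw [h1]
  refine Real.sqrt_le_iff.mpr ⟨Real.exp_nonneg _, ?_⟩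
  have h2 : ((n : ℕ) : ℝ) ≤ 2 ^ (n : ℕ) := by exact_mod_cast Nat.lt_two_pow_self.le
  have h3 : (2 : ℝ) ^ (n : ℕ) ≤ Real.exp n := by
    rw [← Real.exp_one_pow]
    have := Real.add_one_le_exp (1 : ℝ)
    gcongr
    linarith
  push_cast
  rw [sq]
  gcongr
  exact h2.trans h3

/-- Union over the signs `s = ±1`. Of the `2` in the exponent, one unit pays for `√(card)` and one
for the factor 2 of the union; the `+ 1` multiplying `t` is the strict gap required by Feynman-Kac.
-/
theorem measure_lt_abs_integral_le {f : ZConfig → ℝ} (hf : IsLocal f) {c : ℤˣ → ZConfig → ℝ}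
    (hc : ∀ z η, 0 ≤ c z η) {K : ℝ} (hK : ∀ z η, c z η ≤ K) :
    ∃ C : ℝ, 0 < C ∧ ∃ R : ℕ, ∀ α : ℝ, 0 < α → ∀ ε : ℝ, 0 < ε → ε ≤ 1 / 2 → ∀ n : ℕ+,
      2 * R + 3 ≤ (n : ℕ) → ∀ {E : Type*} [MeasurableSpace E] (P : Measure E)
      [IsProbabilityMeasure P] (T : ℝ) (μ : PMF (Config n)) (X : ℝ → E → State n),
      IsEnvironmentAndWalk P n c T μ X → ∀ t ∈ Icc 0 T, ∀ δ : ℝ,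
      P {ω | δ < |∫ s in (0 : ℝ)..t, localError n f ε (seenFromWalker (X s ω))|} ≤
      ENNReal.ofReal (Real.exp (n * (2 +
        (K + α * C * (3 * C / (ε * n) + 16 * α * C * (ε + (R + 1) / n)) + 1) * t - α * δ))) := by
  obtain ⟨C, hC, R, h⟩ := exists_form_le hf hc hK
  refine ⟨C, hC, R, ?_⟩
  intro α hα ε hε hε2 n hn E _ P _ T μ X hX t ht δ
  have hn0 : (0 : ℝ) < n := by exact_mod_cast n.pos
  have hn1 : (1 : ℝ) ≤ n := by exact_mod_cast n.pos
  have h' := h α hα ε hε hε2 n hn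
  set β := α * C * (3 * C / (ε * n) + 16 * α * C * (ε + (R + 1) / n))
  have hone : ∀ s : ℝ, |s| ≤ 1 →
      P {ω | n * α * δ ≤ ∫ r in (0 : ℝ)..t,
        s * (n * α) * localError n f ε (seenFromWalker (X r ω))} ≤
      ENNReal.ofReal (Real.exp (n * (1 + (K + β + 1) * t - α * δ))) := fun s hs => by
    refine (measure_le_integral_le hX
      (fun a => s * (n * α) * localError n f ε (seenFromWalker a)) ht
      (l' := n * (K + β + 1)) (by linarith) (h' s hs) (n * α * δ)).trans ?_
    refine ENNReal.ofReal_le_ofReal ?_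
    have : Real.exp (n * (1 + (K + β + 1) * t - α * δ)) =
        Real.exp n * Real.exp (n * (K + β + 1) * t - n * α * δ) := by
      rw [← Real.exp_add]
      ring_nf
    rw [this]
    exact mul_le_mul_of_nonneg_right (sqrt_card_state_le n) (Real.exp_nonneg _)
  have hsub : {ω | δ < |∫ s in (0 : ℝ)..t, localError n f ε (seenFromWalker (X s ω))|} ⊆
      {ω | n * α * δ ≤ ∫ r in (0 : ℝ)..t,
        1 * (n * α) * localError n f ε (seenFromWalker (X r ω))} ∪
      {ω | n * α * δ ≤ ∫ r in (0 : ℝ)..t,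
        (-1) * (n * α) * localError n f ε (seenFromWalker (X r ω))} := by
    intro ω hω
    have hω' : δ < |∫ s in (0 : ℝ)..t, localError n f ε (seenFromWalker (X s ω))| := hω
    rw [lt_abs] at hω'
    simp only [mem_union, mem_ofPred_eq, intervalIntegral.integral_const_mul]
    have hna : 0 < (n : ℝ) * α := by positivity
    rcases hω' with h1 | h1
    · left
      rw [one_mul]
      exact mul_le_mul_of_nonneg_left h1.le hna.le
    · right
      rw [neg_one_mul, neg_mul, ← mul_neg]
      exact mul_le_mul_of_nonneg_left h1.le hna.le
  refine (measure_mono hsub).trans ((measure_union_le _ _).trans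
    ((add_le_add (hone 1 (by simp)) (hone (-1) (by simp))).trans ?_))
  rw [← ENNReal.ofReal_add (Real.exp_nonneg _) (Real.exp_nonneg _)]
  refine ENNReal.ofReal_le_ofReal ?_
  have h2 : Real.exp (n * (2 + (K + β + 1) * t - α * δ)) =
      Real.exp n * Real.exp (n * (1 + (K + β + 1) * t - α * δ)) := by
    rw [← Real.exp_add]
    ring_nf
  rw [h2, ← two_mul]
  refine mul_le_mul_of_nonneg_right ?_ (Real.exp_nonneg _)
  have := Real.add_one_le_exp (n : ℝ)
  linarith

theorem one_div_mul_log_le {n : ℕ+} {x : ENNReal} {y : ℝ}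
    (h : x ≤ ENNReal.ofReal (Real.exp (n * y))) :
    ((1 / (n : ℝ) : ℝ) : EReal) * ENNReal.log x ≤ (y : EReal) := by
  have hn0 : (0 : ℝ) < n := by exact_mod_cast n.pos
  have h1 : ENNReal.log x ≤ ((n * y : ℝ) : EReal) := by
    refine (ENNReal.log_le_log_iff.mpr h).trans ?_
    rw [ENNReal.log_ofReal, if_neg (not_le.mpr (Real.exp_pos _)), Real.log_exp]
  refine (mul_le_mul_of_nonneg_left h1 (by
    exact_mod_cast (by positivity : (0 : ℝ) ≤ 1 / (n : ℝ)))).trans ?_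
  rw [← EReal.coe_mul, EReal.coe_le_coe_iff]
  field_simp
  exact le_rfl

theorem tendsto_natCast_pnat : Tendsto (fun n : ℕ+ => ((n : ℕ) : ℝ)) atTop atTop :=
  tendsto_natCast_atTop_atTop.comp
    (tendsto_atTop_atTop.mpr fun b => ⟨b.succPNat, fun _ hn =>
      (Nat.le_succ b).trans (PNat.coe_le_coe _ _ |>.mpr hn)⟩)

end ExclusionWalk

end

/-! ### Order of limits: `n → ∞`, then `ε → 0`, at fixed `α` -/

theorem mainTheorem5 (T : ℝ) (hT : 0 < T)
    (c : ℤˣ → ExclusionWalk.ZConfig → ℝ) (hc_nonneg : ∀ z η, 0 ≤ c z η)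
    (hc_local : ∀ z, ExclusionWalk.IsLocal (c z))
    (μ : ∀ n : ℕ+, PMF (ExclusionWalk.Config n))
    (E : ℕ+ → Type*) [∀ n, MeasurableSpace (E n)] (P : ∀ n, Measure (E n))
    [∀ n, IsProbabilityMeasure (P n)]
    (X : ∀ n : ℕ+, ℝ → E n → ExclusionWalk.State n)
    (hX : ∀ n, ExclusionWalk.IsEnvironmentAndWalk (P n) n c T (μ n) (X n))
    (f : ExclusionWalk.ZConfig → ℝ) (hf : ExclusionWalk.IsLocal f)
    (δ : ℝ) (hδ : 0 < δ) (t : ℝ) (ht : t ∈ Icc 0 T) :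
    limsup (fun ε : ℝ =>
      limsup (fun n : ℕ+ =>
        ((1 / (n : ℝ) : ℝ) : EReal) * ENNReal.log (P n {ω |
          δ < |∫ s in (0 : ℝ)..t, ExclusionWalk.localError n f ε
                (ExclusionWalk.seenFromWalker (X n s ω))|}))
        atTop) (𝓝[>] 0) = ⊥ := by
  choose K₀ hK₀ using fun z => (hc_local z).exists_le
  obtain ⟨K, hK⟩ := (Set.finite_range K₀).bddAbove
  have hK' : ∀ z η, c z η ≤ K := fun z η => (hK₀ z η).trans (hK ⟨z, rfl⟩)
  have hK0 : 0 ≤ K := (hc_nonneg 1 fun _ => false).trans (hK' 1 _)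
  obtain ⟨C, hC, R, hbound⟩ := ExclusionWalk.measure_lt_abs_integral_le hf hc_nonneg hK'
  rw [EReal.eq_bot_iff_forall_lt]
  intro y
  -- `α` depends only on the target level `y`, with `K + 2` anticipating `β < 1`. The margin `y - 1`
  -- leaves room for a strict inequality after the limsups.
  obtain ⟨α, hα, hαy⟩ : ∃ α : ℝ, 0 < α ∧ 2 + (K + 2) * T - α * δ ≤ y - 1 := by
    refine ⟨(|y - 1 - (2 + (K + 2) * T)| + 1) / δ, by positivity, ?_⟩
    rw [div_mul_cancel₀ _ hδ.ne']
    have := neg_abs_le (y - 1 - (2 + (K + 2) * T))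
    linarith
  refine lt_of_le_of_lt ?_ (EReal.coe_lt_coe_iff.mpr (sub_one_lt y))
  refine limsup_le_of_le (h := ?_)
  -- The function here is the limit of `β` as `n → ∞`; it is below 1 for small `ε`, however large
  -- `α` is.
  have hlim : Tendsto (fun ε : ℝ => 16 * α * C * (α * C) * ε) (𝓝[>] 0) (𝓝 0) := by
    have : Continuous fun ε : ℝ => 16 * α * C * (α * C) * ε := by fun_prop
    simpa using (this.tendsto 0).mono_left nhdsWithin_le_nhds
  filter_upwards [hlim.eventually (gt_mem_nhds one_pos), self_mem_nhdsWithin,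
    nhdsWithin_le_nhds (gt_mem_nhds (by norm_num : (0 : ℝ) < 1 / 2))] with ε hε1 (hε0 : 0 < ε) hε2
  refine limsup_le_of_le (h := ?_)
  have hβ : Tendsto (fun n : ℕ+ => α * C * (3 * C / (ε * n) + 16 * α * C * (ε + (R + 1) / n)))
      atTop (𝓝 (α * C * (0 + 16 * α * C * (ε + 0)))) := by
    have h1 : Tendsto (fun n : ℕ+ => 3 * C / (ε * n)) atTop (𝓝 0) :=
      tendsto_const_nhds.div_atTop (ExclusionWalk.tendsto_natCast_pnat.const_mul_atTop hε0)
    have h2 : Tendsto (fun n : ℕ+ => ((R : ℝ) + 1) / n) atTop (𝓝 0) :=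
      tendsto_const_nhds.div_atTop ExclusionWalk.tendsto_natCast_pnat
    exact (h1.add ((tendsto_const_nhds.add h2).const_mul _)).const_mul _
  have hβ1 : α * C * (0 + 16 * α * C * (ε + 0)) < 1 := by
    calc _ = 16 * α * C * (α * C) * ε := by ring
      _ < 1 := hε1
  filter_upwards [hβ.eventually (gt_mem_nhds hβ1),
    ExclusionWalk.tendsto_natCast_pnat.eventually_ge_atTop (2 * R + 3)] with n hn hnR
  refine (ExclusionWalk.one_div_mul_log_le (hbound α hα ε hε0 hε2.le n (by exact_mod_cast hnR)
    (P n) T (μ n) (X n) (hX n) t ht δ)).trans ?_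
  rw [EReal.coe_le_coe_iff]
  have h1 : (K + α * C * (3 * C / (ε * n) + 16 * α * C * (ε + (R + 1) / n)) + 1) * t ≤
      (K + 2) * T := by
    refine mul_le_mul (by linarith) ht.2 ht.1 (by linarith)
  linarith
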